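/- **The finite system.** Let $\lambda,\beta>0$ and let $L_n>0$ $(n\ge 1)$ satisfy $n/L_n\to\lambda$ as $n\to\infty$. On a probability space, for every $n\ge1$, let $n-1$ independent random points, uniformly distributed on $\Lambda_n=[-L_n/2,L_n/2]$, be given (no assumption is made on the joint law for different $n$). Ordered increasingly and together with $x_0=-L_n/2$, $x_n=L_n/2$ they cut $\Lambda_n$ into $n$ intervals $I_j=(x_{j-1},x_j)$ of lengths $\ell_j=\ell_j^{\omega}$, $j=1,\dots,n$. On each interval consider the Dirichlet eigenvalues and normalized eigenfunctions of $-\frac12\frac{d^2}{dx^2}$, for $s=1,2,\dots$: $$E_s(\ell_j)=\frac{\pi^2s^2}{2\ell_j^2},\qquad \psi_{j,s}(x)=\mathbb 1_{I_j}(x)\sqrt{\tfrac{2}{\ell_j}}\,\sin\Big(\tfrac{\pi s}{\ell_j}(x-x_{j-1})\Big).$$ For $\mu<\min_jE_1(\ell_j)$ define the particle density, the one-body reduced density matrix and its space average by $$\rho_n^\omega(\beta,\mu)=\frac1{L_n}\sum_{j=1}^n\sum_{s\ge1}\frac1{e^{\beta(E_s(\ell_j)-\mu)}-1},\qquad \rho_n^\omega(x,y;\beta,\mu)=\sum_{j=1}^n\sum_{s\ge1}\frac{\psi_{j,s}(x)\,\psi_{j,s}(y)}{e^{\beta(E_s(\ell_j)-\mu)}-1},$$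 $$\tilde\rho_n^\omega(x,y;\beta,\mu)=\frac1{L_n}\int_{-L_n/2}^{L_n/2}\rho_n^\omega(x+z,y+z;\beta,\mu)\,dz .$$ **The critical density.** With $c=\pi/\sqrt2$ and $$n_\lambda(E)=\frac{\lambda^2c}{2}\,\frac{e^{c\lambda/\sqrt E}}{E^{3/2}(e^{c\lambda/\sqrt E}-1)^2},$$ set $\rho_c(\beta)=\lim_{\mu\uparrow0}\int_0^\infty\frac{n_\lambda(E)}{e^{\beta(E-\mu)}-1}\,dE$. **Claim.** The limit defining $\rho_c(\beta)$ exists and is finite. Let $\rho>\rho_c(\beta)$. Then: 1. Almost surely, for every $n\ge1$ the equation $\rho_n^\omega(\beta,\mu)=\rho$ has exactly one solution $\mu=\mu_n^\omega(\beta,\rho)<\min_jE_1(\ell_j)$, and almost surely $\mu_n^\omega(\beta,\rho)\to0$ as $n\to\infty$. 2. The condensate density $$\rho_0(\beta,\rho)=\lim_{\epsilon\downarrow0}\ \text{a.s.}\lim_{n\to\infty}\frac1{L_n}\sum_{(j,s):\,E_s(\ell_j)\le\epsilon}\frac1{e^{\beta(E_s(\ell_j)-\mu_n^\omega(\beta,\rho))}-1}$$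 exists (for every $\epsilon>0$ the inner almost sure limit exists and is nonrandom), and $\rho_0(\beta,\rho)=\rho-\rho_c(\beta)>0$. 3. For all $x,y\in\mathbb R$ the space-averaged reduced density matrix $\tilde\rho_n^\omega(x,y;\beta,\mu_n^\omega(\beta,\rho))$ converges almost surely, as $n\to\infty$, to a nonrandom limit $\tilde\rho(x,y)$. 4. There is off-diagonal long-range order, equal to the condensate density: $$\lim_{|x-y|\to\infty}\tilde\rho(x,y)=\rho_0(\beta,\rho).$$ -/

import Mathlib

open Real Set Filter Topology MeasureTheory ProbabilityTheory

noncomputable section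

namespace LuttingerSy

/-! ### The Dirichlet Laplacian `-½ d²/dx²` on an interval -/

/-- `f` is an eigenfunction, with eigenvalue `E`, of `-½ d²/dx²` on `[a, b]` with Dirichlet
boundary conditions. -/
def IsDirichletEigenfunction (a b E : ℝ) (f : ℝ → ℝ) : Prop :=
  (∃ f' f'' : ℝ → ℝ,
    (∀ x ∈ Icc a b, HasDerivWithinAt f (f' x) (Icc a b) x) ∧
    (∀ x ∈ Icc a b, HasDerivWithinAt f' (f'' x) (Icc a b) x) ∧
    (∀ x ∈ Icc a b, -(1 / 2) * f'' x = E * f x)) ∧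
  f a = 0 ∧ f b = 0 ∧ ∃ x ∈ Icc a b, f x ≠ 0

/-- The `s`-th Dirichlet eigenvalue, `s = 1, 2, …`, of `-½ d²/dx²` on an interval of
length `ℓ`. -/
def energy (ℓ : ℝ) (s : ℕ) : ℝ := (1 / 2) * (π ^ 2 * (s : ℝ) ^ 2 / ℓ ^ 2)

/-- The `s`-th normalized Dirichlet eigenfunction on `(a, b)`, extended by zero. -/
def eigenfun (a b : ℝ) (s : ℕ) (x : ℝ) : ℝ :=
  (Ioo a b).indicator (fun x => √(2 / (b - a)) * Real.sin (π * s / (b - a) * (x - a))) x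

/-! ### The finite system: `N` impurities in `[-L/2, L/2]`, hence `N + 1` intervals -/

/-- The points `-L/2 = x₀ ≤ x₁ ≤ … ≤ x_N ≤ x_{N+1} = L/2`, where `x₁, …, x_N` are the impurity
positions `x` in increasing order. -/
def node {N : ℕ} (L : ℝ) (x : Fin N → ℝ) : Fin (N + 2) → ℝ :=
  Fin.cons (α := fun _ => ℝ) (-L / 2)
    (Fin.snoc (α := fun _ => ℝ) (x ∘ Tuple.sort x) (L / 2))

/-- Left end-point of the `j`-th interval. -/
def left {N : ℕ} (L : ℝ) (x : Fin N → ℝ) (j : Fin (N + 1)) : ℝ := node L x j.castSucc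

/-- Right end-point of the `j`-th interval. -/
def right {N : ℕ} (L : ℝ) (x : Fin N → ℝ) (j : Fin (N + 1)) : ℝ := node L x j.succ

/-- Length of the `j`-th interval. -/
def gap {N : ℕ} (L : ℝ) (x : Fin N → ℝ) (j : Fin (N + 1)) : ℝ := right L x j - left L x j

/-- Bose–Einstein occupation number of a level of energy `E`. -/
def occ (β μ E : ℝ) : ℝ := 1 / (Real.exp (β * (E - μ)) - 1)

/-- Grand-canonical particle density of the finite system. -/
def density {N : ℕ} (L : ℝ) (x : Fin N → ℝ) (β μ : ℝ) : ℝ :=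
  (1 / L) * ∑ j : Fin (N + 1), ∑' s : ℕ, occ β μ (energy (gap L x j) (s + 1))

/-- Density of the particles in the levels of energy at most `ε`, i.e. the integral over
`(0, ε]` of the occupation number against the finite-volume density-of-states measure. -/
def lowDensity {N : ℕ} (L : ℝ) (x : Fin N → ℝ) (β μ ε : ℝ) : ℝ :=
  (1 / L) * ∑ j : Fin (N + 1), ∑' s : ℕ,
    (Iic ε).indicator (occ β μ) (energy (gap L x j) (s + 1))

/-- `μ` lies below the spectrum and solves `ρ = ρ_L(β, μ)`. -/
def IsChemPot {N : ℕ} (L : ℝ) (x : Fin N → ℝ) (β ρ μ : ℝ) : Prop :=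
  (∀ (j : Fin (N + 1)) (s : ℕ), μ < energy (gap L x j) (s + 1)) ∧ density L x β μ = ρ

open Classical in
/-- The finite-volume chemical potential at density `ρ`: the solution of `IsChemPot`
(and `0` if there is none). -/
def chemPot {N : ℕ} (L : ℝ) (x : Fin N → ℝ) (β ρ : ℝ) : ℝ :=
  if h : ∃ μ, IsChemPot L x β ρ μ then h.choose else 0

/-- Kernel of the one-body reduced density matrix of the finite system. -/
def densityMatrix {N : ℕ} (L : ℝ) (x : Fin N → ℝ) (β μ : ℝ) (u v : ℝ) : ℝ :=
  ∑ j : Fin (N + 1), ∑' s : ℕ, occ β μ (energy (gap L x j) (s + 1)) *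
    (eigenfun (left L x j) (right L x j) (s + 1) u *
      eigenfun (left L x j) (right L x j) (s + 1) v)

/-- The space-averaged reduced density matrix of the finite system. -/
def avgDensityMatrix {N : ℕ} (L : ℝ) (x : Fin N → ℝ) (β μ : ℝ) (u v : ℝ) : ℝ :=
  (1 / L) * ∫ z in (-L / 2)..(L / 2), densityMatrix L x β μ (u + z) (v + z)

/-! ### Infinite-volume quantities -/

/-- Limiting density of states, with `c = π / √2`. -/
def dos (lam E : ℝ) : ℝ :=
  lam ^ 2 * (π / √2) / 2 *
    (Real.exp (π / √2 * lam / √E) /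
      (E ^ (3 / 2 : ℝ) * (Real.exp (π / √2 * lam / √E) - 1) ^ 2))

/-- Limiting grand-canonical density for `μ < 0`. -/
def limDensity (lam β μ : ℝ) : ℝ := ∫ E in Ioi (0 : ℝ), dos lam E * occ β μ E

/-- Critical density: the limit of `limDensity` as `μ ↑ 0`. -/
def critDensity (lam β : ℝ) : ℝ := limUnder (𝓝[<] (0 : ℝ)) (limDensity lam β)

/-! ### `energy` and `eigenfun` are the Dirichlet eigenvalues and eigenfunctions -/

/-- On a nondegenerate interval, the Dirichlet eigenfunctions of `-½ d²/dx²` are exactly the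
nonzero multiples of the functions `eigenfun a b s`, `s ≥ 1`, with eigenvalues
`energy (b - a) s`. -/
theorem isDirichletEigenfunction_iff {a b : ℝ} (hab : a < b) (E : ℝ) (f : ℝ → ℝ) :
    IsDirichletEigenfunction a b E f ↔
      ∃ s : ℕ, 1 ≤ s ∧ E = energy (b - a) s ∧
        ∃ C : ℝ, C ≠ 0 ∧ ∀ x ∈ Icc a b, f x = C * eigenfun a b s x := by
  have hℓ : 0 < b - a := sub_pos.2 hab
  have haI : a ∈ Icc a b := ⟨le_rfl, hab.le⟩
  have hbI : b ∈ Icc a b := ⟨hab.le, le_rfl⟩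
  -- on the closed interval the indicator is invisible
  have heig : ∀ (s : ℕ), ∀ x ∈ Icc a b,
      eigenfun a b s x = √(2 / (b - a)) * Real.sin (π * s / (b - a) * (x - a)) := by
    intro s x hx
    unfold eigenfun
    by_cases h : x ∈ Ioo a b
    · rw [indicator_of_mem h]
    · rw [indicator_of_notMem h]
      have : x = a ∨ x = b := by
        rcases eq_or_lt_of_le hx.1 with h1 | h1
        · exact Or.inl h1.symm
        · rcases eq_or_lt_of_le hx.2 with h2 | h2
          · exact Or.inr h2
          · exact absurd ⟨h1, h2⟩ h
      rcases this with rfl | rfl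
      · simp
      · have : π * s / (x - a) * (x - a) = s * π := by field_simp
        rw [this, Real.sin_nat_mul_pi, mul_zero]
  have hsq : 0 < √(2 / (b - a)) := Real.sqrt_pos.2 (by positivity)
  constructor
  · rintro ⟨⟨f', f'', h1, h2, h3⟩, hfa, hfb, x₀, hx₀, hfx₀⟩
    have h2' : ∀ x ∈ Icc a b, HasDerivWithinAt f' (-(2 * E) * f x) (Icc a b) x := by
      intro x hx
      have : f'' x = -(2 * E) * f x := by linarith [h3 x hx]
      exact this ▸ h2 x hx
    have const : ∀ g : ℝ → ℝ, (∀ x ∈ Icc a b, HasDerivWithinAt g 0 (Icc a b) x) →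
        ∀ x ∈ Icc a b, g x = g a := by
      intro g hg x hx
      refine constant_of_has_deriv_right_zero (fun y hy => (hg y hy).continuousWithinAt)
        (fun y hy => ?_) x hx
      exact (hg y ⟨hy.1, hy.2.le⟩).mono_of_mem_nhdsWithin
        (Icc_mem_nhdsGE_of_mem hy)
    have hEpos : 0 < E := by
      by_contra hE
      push Not at hE
      have hmono : MonotoneOn (fun x => f x * f' x) (Icc a b) := by
        refine monotoneOn_of_hasDerivWithinAt_nonneg (convex_Icc a b)
          (f' := fun x => f' x * f' x + f x * (-(2 * E) * f x)) (fun y hy =>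
            ((h1 y hy).mul (h2' y hy)).continuousWithinAt) (fun y hy => ?_) (fun y hy => ?_)
        · have hy' := interior_subset hy
          exact ((h1 y hy').mul (h2' y hy')).mono interior_subset
        · nlinarith [mul_self_nonneg (f' y), mul_self_nonneg (f y),
            mul_nonneg (neg_nonneg.2 hE) (mul_self_nonneg (f y))]
      have hzero : ∀ x ∈ Icc a b, f x * f' x = 0 := by
        intro x hx
        have l := hmono haI hx hx.1
        have r := hmono hx hbI hx.2
        simp only [hfa, hfb, zero_mul] at l r
        exact le_antisymm r l
      have hsqc := const (fun x => f x * f x) (fun x hx => by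
        have := (h1 x hx).mul (h1 x hx)
        have e : f' x * f x + f x * f' x = 0 := by linarith [hzero x hx, mul_comm (f x) (f' x)]
        exact e ▸ this) x₀ hx₀
      simp only [hfa, mul_zero] at hsqc
      exact hfx₀ (mul_self_eq_zero.1 hsqc)
    set k : ℝ := √(2 * E) with hk
    have hkpos : 0 < k := Real.sqrt_pos.2 (by positivity)
    have hk2 : k * k = 2 * E := Real.mul_self_sqrt (by positivity)
    have hsin : ∀ x, HasDerivWithinAt (fun x => Real.sin (k * (x - a)))
        (Real.cos (k * (x - a)) * k) (Icc a b) x := by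
      intro x
      have : HasDerivAt (fun x => k * (x - a)) k x := by
        simpa using ((hasDerivAt_id x).sub_const a).const_mul k
      exact this.sin.hasDerivWithinAt
    have hcos : ∀ x, HasDerivWithinAt (fun x => Real.cos (k * (x - a)))
        (-Real.sin (k * (x - a)) * k) (Icc a b) x := by
      intro x
      have : HasDerivAt (fun x => k * (x - a)) k x := by
        simpa using ((hasDerivAt_id x).sub_const a).const_mul k
      exact this.cos.hasDerivWithinAt
    have hP := const
      (fun x => f' x * Real.sin (k * (x - a)) - k * (f x * Real.cos (k * (x - a)))) (by
        intro x hx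
        have := ((h2' x hx).mul (hsin x)).sub (((h1 x hx).mul (hcos x)).const_mul k)
        refine this.congr_deriv ?_
        linear_combination ((f x) * Real.sin (k * (x - a))) * hk2)
    have hQ := const
      (fun x => f' x * Real.cos (k * (x - a)) + k * (f x * Real.sin (k * (x - a)))) (by
        intro x hx
        have := ((h2' x hx).mul (hcos x)).add (((h1 x hx).mul (hsin x)).const_mul k)
        refine this.congr_deriv ?_
        linear_combination ((f x) * Real.cos (k * (x - a))) * hk2)
    have hform : ∀ x ∈ Icc a b, k * f x = f' a * Real.sin (k * (x - a)) := by
      intro x hx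
      have p := hP x hx
      have q := hQ x hx
      simp only [sub_self, mul_zero, Real.sin_zero, Real.cos_zero, hfa, mul_one,
        add_zero] at p q
      linear_combination (Real.sin (k * (x - a))) * q - (Real.cos (k * (x - a))) * p
        - k * f x * (Real.sin_sq_add_cos_sq (k * (x - a)))
    have hA : f' a ≠ 0 := by
      intro h
      have := hform x₀ hx₀
      rw [h, zero_mul] at this
      exact hfx₀ ((mul_eq_zero.1 this).resolve_left hkpos.ne')
    have hs0 : Real.sin (k * (b - a)) = 0 := by
      have := hform b hbI
      rw [hfb, mul_zero] at this
      exact (mul_eq_zero.1 this.symm).resolve_left hA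
    obtain ⟨m, hm⟩ := Real.sin_eq_zero_iff.1 hs0
    have hmpos : 0 < m := by
      have : (0 : ℝ) < m * π := hm ▸ mul_pos hkpos hℓ
      exact_mod_cast (pos_of_mul_pos_left this Real.pi_pos.le)
    obtain ⟨s, rfl⟩ := Int.eq_ofNat_of_zero_le hmpos.le
    have hkval : k = π * s / (b - a) := by
      rw [eq_div_iff hℓ.ne', ← hm]; push_cast; ring
    refine ⟨s, by exact_mod_cast hmpos, ?_, f' a / (k * √(2 / (b - a))), by positivity, ?_⟩
    · have : E = (1 / 2) * (k * k) := by rw [hk2]; ring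
      rw [this, hkval, energy]
      field_simp
    · intro x hx
      rw [heig s x hx, ← hkval]
      have := hform x hx
      field_simp
      linarith
  · rintro ⟨s, hs, rfl, C, hC, hf⟩
    set k : ℝ := π * s / (b - a) with hk
    set D : ℝ := C * √(2 / (b - a)) with hD
    have hf' : ∀ x ∈ Icc a b, f x = D * Real.sin (k * (x - a)) := by
      intro x hx; rw [hf x hx, heig s x hx]; ring
    have hlin : ∀ x, HasDerivAt (fun x => k * (x - a)) k x := by
      intro x
      simpa using ((hasDerivAt_id x).sub_const a).const_mul k
    have hs' : (0 : ℝ) < s := by exact_mod_cast hs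
    refine ⟨⟨fun x => D * (Real.cos (k * (x - a)) * k),
      fun x => D * (-Real.sin (k * (x - a)) * k * k), ?_, ?_, ?_⟩, ?_, ?_, ?_⟩
    · intro x hx
      exact (((hlin x).sin.const_mul D).hasDerivWithinAt).congr hf' (hf' x hx)
    · intro x _
      exact (((hlin x).cos.mul_const k).const_mul D).hasDerivWithinAt
    · intro x hx
      rw [hf' x hx, energy, hk]
      field_simp
    · rw [hf' a haI]; simp
    · rw [hf' b hbI]
      have : k * (b - a) = s * π := by rw [hk]; field_simp
      rw [this, Real.sin_nat_mul_pi, mul_zero]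
    · refine ⟨a + (b - a) / (2 * s), ⟨by linarith [show 0 < (b - a) / (2 * s) by positivity], ?_⟩, ?_⟩
      · have : (b - a) / (2 * s) ≤ b - a := by
          apply div_le_self hℓ.le
          have : (1 : ℝ) ≤ s := by exact_mod_cast hs
          linarith
        linarith
      · have hmem : a + (b - a) / (2 * s) ∈ Icc a b := by
          refine ⟨by linarith [show 0 < (b - a) / (2 * s) by positivity], ?_⟩
          have : (b - a) / (2 * s) ≤ b - a := by
            apply div_le_self hℓ.le
            have : (1 : ℝ) ≤ s := by exact_mod_cast hs
            linarith
          linarith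
        rw [hf' _ hmem]
        have : k * (a + (b - a) / (2 * s) - a) = π / 2 := by rw [hk]; field_simp; ring
        rw [this, Real.sin_pi_div_two, mul_one]
        exact mul_ne_zero hC hsq.ne'

end LuttingerSy

end

/-!
The positions of an impurity-free window of length `t` form a set of measure `∑ⱼ (ℓⱼ - t)₊`. Moving
one impurity changes this measure by at most `t`, so McDiarmid's inequality and the Borel–Cantelli
lemma give, almost surely, `L⁻¹ ∑ⱼ (ℓⱼ - t)₊ → e^{-λt}`. The left-hand side is convex in `t`, so its
derivative converges too: the size-biased law of the interval lengths converges weakly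
to the gamma law with density `λ² t e^{-λt}`. The rest of the argument is deterministic.

The sums over the levels above a cutoff `ε` obey a law of large numbers, because there the
occupation numbers are dominated by Boltzmann weights. In particular the chemical potential must
tend to `0`: otherwise the particle density would have a limit different from `ρ`. The levels
above `ε` then hold in the limit at most the critical density, so the remaining `ρ - ρ_c` sits at
energies below `ε`, for every `ε`.

Each level contributes to the averaged density matrix its occupation times the overlap of its
eigenfunction with its translate by `|x - y|`. At low energies the interval is long and the
overlap is close to `1`; at high energies the contribution vanishes as `|x - y| → ∞`, since the
overlap is nonzero only on intervals longer than `|x - y|`.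
-/

noncomputable section

namespace LuttingerSy

/-! ### Energy levels and occupation numbers -/

lemma energy_pos {ℓ : ℝ} (hℓ : 0 < ℓ) (s : ℕ) : 0 < energy ℓ (s + 1) := by
  unfold energy; push_cast; positivity

lemma monotone_energy (ℓ : ℝ) : Monotone (energy ℓ) := by
  intro s t hst
  have hst' : (s : ℝ) ≤ t := by exact_mod_cast hst
  unfold energy
  gcongr

lemma energy_one_le (ℓ : ℝ) (s : ℕ) : energy ℓ 1 ≤ energy ℓ (s + 1) :=
  monotone_energy ℓ (Nat.le_add_left 1 s)

lemma strictAntiOn_energy (s : ℕ) : StrictAntiOn (fun ℓ => energy ℓ (s + 1)) (Ioi 0) := by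
  intro ℓ hℓ m _ hlt
  rw [mem_Ioi] at hℓ
  simp only [energy, Nat.cast_add_one]
  gcongr

lemma measurable_energy (s : ℕ) : Measurable (fun ℓ => energy ℓ s) := by
  unfold energy; fun_prop

lemma continuousAt_energy {ℓ : ℝ} (hℓ : ℓ ≠ 0) (s : ℕ) :
    ContinuousAt (fun ℓ => energy ℓ s) ℓ := by
  unfold energy
  exact continuousAt_const.mul (continuousAt_const.div (by fun_prop) (pow_ne_zero 2 hℓ))

lemma ae_energy_ne (ε : ℝ) :
    ∀ᵐ ℓ ∂volume.restrict (Ioi (0 : ℝ)), ∀ s : ℕ, energy ℓ (s + 1) ≠ ε := by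
  refine ae_all_iff.2 fun s => (ae_restrict_iff' measurableSet_Ioi).2 ?_
  have hsub : {ℓ | ℓ ∈ Ioi (0 : ℝ) ∧ energy ℓ (s + 1) = ε}.Subsingleton :=
    fun ℓ hℓ m hm => (strictAntiOn_energy s).injOn hℓ.1 hm.1 (hℓ.2.trans hm.2.symm)
  filter_upwards [measure_eq_zero_iff_ae_notMem.1 (hsub.measure_zero volume)] with ℓ hℓ hpos heq
  exact hℓ ⟨hpos, heq⟩

lemma hasSum_one_div_energy (ℓ : ℝ) :
    HasSum (fun s : ℕ => 1 / energy ℓ (s + 1)) (ℓ ^ 2 / 3) := by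
  have hzeta : HasSum (fun s : ℕ => 1 / ((s + 1 : ℕ) : ℝ) ^ 2) (π ^ 2 / 6) := by
    simpa using (hasSum_nat_add_iff' (f := fun n : ℕ => 1 / (n : ℝ) ^ 2) 1).2 hasSum_zeta_two
  convert! hzeta.mul_left (2 * ℓ ^ 2 / π ^ 2) using 1
  · funext s
    rw [energy]
    field_simp
  · field_simp
    ring

lemma antitoneOn_exp_neg_mul_sq {b : ℝ} (hb : 0 ≤ b) :
    AntitoneOn (fun x : ℝ => exp (-b * x ^ 2)) (Ici 0) := by
  intro x hx y _ hxy
  rw [mem_Ici] at hx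
  simp only [neg_mul]
  gcongr

lemma summable_exp_neg_mul_succ_sq {b : ℝ} (hb : 0 < b) :
    Summable (fun s : ℕ => exp (-b * ((s + 1 : ℕ) : ℝ) ^ 2)) :=
  (summable_nat_add_iff 1).2 <| (antitoneOn_exp_neg_mul_sq hb.le).summable_of_integrableOn_Ioi_zero
    (integrable_exp_neg_mul_sq hb).integrableOn fun _ _ => (exp_pos _).le

lemma tsum_exp_neg_mul_succ_sq_le {b : ℝ} (hb : 0 < b) :
    ∑' s : ℕ, exp (-b * ((s + 1 : ℕ) : ℝ) ^ 2) ≤ √(π / b) / 2 :=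
  ((antitoneOn_exp_neg_mul_sq hb.le).tsum_add_one_le_integral
    (integrable_exp_neg_mul_sq hb).integrableOn fun _ _ => (exp_pos _).le).trans_eq
    (integral_gaussian_Ioi b)

section Boltzmann

variable {β ℓ K : ℝ} {f : ℕ → ℝ}

lemma exp_neg_mul_energy (β ℓ : ℝ) (s : ℕ) :
    exp (-β * energy ℓ s) = exp (-(β * π ^ 2 / (2 * ℓ ^ 2)) * (s : ℝ) ^ 2) := by
  unfold energy
  ring_nf

lemma summable_exp_neg_mul_energy (hβ : 0 < β) (hℓ : 0 < ℓ) :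
    Summable (fun s : ℕ => exp (-β * energy ℓ (s + 1))) := by
  simp_rw [exp_neg_mul_energy]
  exact summable_exp_neg_mul_succ_sq (by positivity)

lemma tsum_exp_neg_mul_energy_le (hβ : 0 < β) (hℓ : 0 < ℓ) :
    ∑' s : ℕ, exp (-β * energy ℓ (s + 1)) ≤ ℓ / √(2 * π * β) := by
  simp_rw [exp_neg_mul_energy]
  refine (tsum_exp_neg_mul_succ_sq_le (by positivity)).trans_eq ?_
  have hsq : π / (β * π ^ 2 / (2 * ℓ ^ 2)) = (2 * ℓ) ^ 2 / (2 * π * β) := by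
    field_simp
  rw [hsq, sqrt_div (by positivity), sqrt_sq (by positivity)]
  ring

lemma summable_of_abs_le_exp_energy (hβ : 0 < β) (hℓ : 0 < ℓ)
    (hf : ∀ s, |f s| ≤ K * exp (-β * energy ℓ (s + 1))) : Summable f :=
  Summable.of_norm_bounded ((summable_exp_neg_mul_energy hβ hℓ).mul_left K) hf

lemma abs_tsum_le_of_abs_le_exp_energy (hβ : 0 < β) (hℓ : 0 < ℓ)
    (hf : ∀ s, |f s| ≤ K * exp (-β * energy ℓ (s + 1))) :
    |∑' s, f s| ≤ K * (ℓ / √(2 * π * β)) := by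
  have hK : 0 ≤ K := nonneg_of_mul_nonneg_left ((abs_nonneg _).trans (hf 0)) (exp_pos _)
  calc |∑' s, f s| ≤ ∑' s : ℕ, K * exp (-β * energy ℓ (s + 1)) :=
        tsum_of_norm_bounded (f := f) ((summable_exp_neg_mul_energy hβ hℓ).mul_left K).hasSum hf
    _ = K * ∑' s : ℕ, exp (-β * energy ℓ (s + 1)) := tsum_mul_left
    _ ≤ K * (ℓ / √(2 * π * β)) := by
        gcongr
        exact tsum_exp_neg_mul_energy_le hβ hℓ

end Boltzmann

section Occupation

variable {β ε μ ν E : ℝ}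

lemma one_lt_exp_mul_sub (hβ : 0 < β) (h : μ < E) : 1 < exp (β * (E - μ)) :=
  one_lt_exp_iff.2 (mul_pos hβ (sub_pos.2 h))

lemma occ_pos (hβ : 0 < β) (h : μ < E) : 0 < occ β μ E :=
  one_div_pos.2 (sub_pos.2 (one_lt_exp_mul_sub hβ h))

lemma strictMonoOn_occ (hβ : 0 < β) (E : ℝ) : StrictMonoOn (fun μ => occ β μ E) (Iio E) := by
  intro μ _ ν hν hlt
  refine one_div_lt_one_div_of_lt (sub_pos.2 (one_lt_exp_mul_sub hβ hν)) ?_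
  gcongr

lemma occ_le_one_div (hβ : 0 < β) (h : μ < E) : occ β μ E ≤ 1 / (β * (E - μ)) :=
  one_div_le_one_div_of_le (mul_pos hβ (sub_pos.2 h))
    (by linarith [add_one_le_exp (β * (E - μ))])

lemma measurable_occ (β μ : ℝ) : Measurable (occ β μ) := by
  unfold occ; fun_prop

lemma continuousAt_uncurry_occ (hβ : 0 < β) (h : μ < E) :
    ContinuousAt (fun p : ℝ × ℝ => occ β p.1 p.2) (μ, E) :=
  continuousAt_const.div (by fun_prop) (sub_pos.2 (one_lt_exp_mul_sub hβ h)).ne'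

lemma continuousAt_occ (hβ : 0 < β) (h : μ < E) : ContinuousAt (occ β μ) E :=
  (continuousAt_uncurry_occ hβ h).comp (f := fun E => (μ, E)) (by fun_prop)

lemma continuousAt_occ_left (hβ : 0 < β) (h : μ < E) : ContinuousAt (fun μ => occ β μ E) μ :=
  (continuousAt_uncurry_occ hβ h).comp (f := fun μ => (μ, E)) (by fun_prop)

/-- The constant comparing the Bose–Einstein occupation numbers of the levels `E ≥ ε` with the
Boltzmann weights `exp (-β * E)`, see `occ_le_boltzmannConst_mul`. -/
def boltzmannConst (β ε μ : ℝ) : ℝ := exp (β * μ) / (1 - exp (-(β * (ε - μ))))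

lemma one_sub_exp_neg_mul_sub_pos (hβ : 0 < β) (h : μ < ε) : 0 < 1 - exp (-(β * (ε - μ))) :=
  sub_pos.2 (exp_lt_one_iff.2 (neg_neg_of_pos (mul_pos hβ (sub_pos.2 h))))

lemma boltzmannConst_pos (hβ : 0 < β) (h : μ < ε) : 0 < boltzmannConst β ε μ :=
  div_pos (exp_pos _) (one_sub_exp_neg_mul_sub_pos hβ h)

lemma occ_eq_boltzmannConst_mul (β μ E : ℝ) : occ β μ E = boltzmannConst β E μ * exp (-β * E) := by
  have hexp : exp (β * μ) * exp (-β * E) = exp (-(β * (E - μ))) := by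
    rw [← exp_add]; ring_nf
  have hinv : exp (β * (E - μ)) = (exp (-(β * (E - μ))))⁻¹ := by rw [exp_neg, inv_inv]
  have hpos := exp_pos (-(β * (E - μ)))
  rw [occ, boltzmannConst, div_mul_eq_mul_div, hexp, hinv, ← one_div, div_sub_one hpos.ne',
    one_div_div]

lemma occ_le_boltzmannConst_mul (hβ : 0 < β) (h : μ < ε) (hE : ε ≤ E) :
    occ β μ E ≤ boltzmannConst β ε μ * exp (-β * E) := by
  have := one_sub_exp_neg_mul_sub_pos hβ h
  rw [occ_eq_boltzmannConst_mul]
  unfold boltzmannConst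
  gcongr

lemma occ_sub_occ (hβ : 0 < β) (hμ : μ < E) (hν : ν < E) :
    occ β μ E - occ β ν E =
      occ β μ E * occ β ν E * (exp (β * E) * (exp (-(β * ν)) - exp (-(β * μ)))) := by
  have hμ' := (sub_pos.2 (one_lt_exp_mul_sub hβ hμ)).ne'
  have hν' := (sub_pos.2 (one_lt_exp_mul_sub hβ hν)).ne'
  rw [mul_sub, ← exp_add, ← exp_add, ← sub_eq_add_neg, ← sub_eq_add_neg, ← mul_sub, ← mul_sub]
  unfold occ
  field_simp
  ring

lemma abs_occ_sub_occ_le (hβ : 0 < β) (hμ : μ < ε) (hν : ν < ε) (hE : ε ≤ E) :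
    |occ β μ E - occ β ν E| ≤ boltzmannConst β ε μ * boltzmannConst β ε ν *
      |exp (-(β * ν)) - exp (-(β * μ))| * exp (-β * E) := by
  have hμE := occ_pos hβ (hμ.trans_le hE)
  have hνE := occ_pos hβ (hν.trans_le hE)
  rw [occ_sub_occ hβ (hμ.trans_le hE) (hν.trans_le hE), abs_mul, abs_mul, abs_mul,
    abs_of_pos hμE, abs_of_pos hνE, abs_of_pos (exp_pos _)]
  calc occ β μ E * occ β ν E * (exp (β * E) * |exp (-(β * ν)) - exp (-(β * μ))|)
      ≤ (boltzmannConst β ε μ * exp (-β * E)) * (boltzmannConst β ε ν * exp (-β * E)) *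
        (exp (β * E) * |exp (-(β * ν)) - exp (-(β * μ))|) := by
        gcongr
        · exact hμE.le.trans (occ_le_boltzmannConst_mul hβ hμ hE)
        · exact occ_le_boltzmannConst_mul hβ hμ hE
        · exact occ_le_boltzmannConst_mul hβ hν hE
    _ = boltzmannConst β ε μ * boltzmannConst β ε ν * |exp (-(β * ν)) - exp (-(β * μ))| *
        exp (-β * E) * (exp (-β * E) * exp (β * E)) := by ring
    _ = _ := by rw [← exp_add, neg_mul, neg_add_cancel, exp_zero, mul_one]

end Occupation

/-! ### Sums over the levels above a cutoff -/

/-- The occupation number of a level of energy `E`, with the levels `E ≤ ε` left out. The high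
energy part of the system, where the occupation numbers are bounded, is built from it. -/
def cutoffOcc (β ε μ : ℝ) : ℝ → ℝ := (Ioi ε).indicator (occ β μ)

/-- The sum of the occupation numbers of the levels above `ε` of an interval of length `ℓ`, the
level `s + 1` being weighted by `a ℓ s`. -/
def cutoffSum (β ε μ : ℝ) (a : ℝ → ℕ → ℝ) (ℓ : ℝ) : ℝ :=
  ∑' s : ℕ, cutoffOcc β ε μ (energy ℓ (s + 1)) * a ℓ s

/-- The thermodynamic limit of the density `L⁻¹ ∑ⱼ cutoffSum β ε μ a ℓⱼ`: in the limit the number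
of intervals per unit volume with length in `dℓ` is `lam ^ 2 * exp (-lam * ℓ) dℓ`. -/
def limCutoffDensity (lam β ε μ : ℝ) (a : ℝ → ℕ → ℝ) : ℝ :=
  lam ^ 2 * ∫ ℓ in Ioi (0 : ℝ), exp (-lam * ℓ) * cutoffSum β ε μ a ℓ

section CutoffOcc

variable {β ε μ ν E : ℝ}

lemma cutoffOcc_of_lt (h : ε < E) : cutoffOcc β ε μ E = occ β μ E := indicator_of_mem h _

lemma cutoffOcc_of_le (h : E ≤ ε) : cutoffOcc β ε μ E = 0 := indicator_of_notMem (not_lt.2 h) _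

lemma indicator_Iic_occ_add_cutoffOcc (β ε μ E : ℝ) :
    (Iic ε).indicator (occ β μ) E + cutoffOcc β ε μ E = occ β μ E := by
  rw [cutoffOcc, ← compl_Iic]
  exact congrFun (indicator_self_add_compl (Iic ε) (occ β μ)) E

lemma measurable_cutoffOcc (β ε μ : ℝ) : Measurable (cutoffOcc β ε μ) :=
  (measurable_occ β μ).indicator measurableSet_Ioi

lemma cutoffOcc_nonneg (hβ : 0 < β) (h : μ ≤ ε) (E : ℝ) : 0 ≤ cutoffOcc β ε μ E :=
  indicator_nonneg (fun _ hE => (occ_pos hβ (h.trans_lt hE)).le) E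

lemma cutoffOcc_le_boltzmannConst_mul (hβ : 0 < β) (h : μ < ε) (E : ℝ) :
    cutoffOcc β ε μ E ≤ boltzmannConst β ε μ * exp (-β * E) :=
  indicator_apply_le' (fun hE => occ_le_boltzmannConst_mul hβ h (le_of_lt hE))
    fun _ => (mul_pos (boltzmannConst_pos hβ h) (exp_pos _)).le

lemma cutoffOcc_le_one_div (hβ : 0 < β) (hμ : μ ≤ 0) (hE : 0 < E) :
    cutoffOcc β ε μ E ≤ 1 / β * (1 / E) := by
  refine indicator_apply_le' (fun _ => ?_) fun _ => by positivity
  calc occ β μ E ≤ 1 / (β * (E - μ)) := occ_le_one_div hβ (hμ.trans_lt hE)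
    _ ≤ 1 / (β * E) := by gcongr; linarith
    _ = 1 / β * (1 / E) := by rw [one_div_mul_one_div]

lemma abs_cutoffOcc_sub_le (hβ : 0 < β) (hμ : μ < ε) (hν : ν < ε) (E : ℝ) :
    |cutoffOcc β ε μ E - cutoffOcc β ε ν E| ≤ boltzmannConst β ε μ * boltzmannConst β ε ν *
      |exp (-(β * ν)) - exp (-(β * μ))| * exp (-β * E) := by
  rcases le_or_gt E ε with hE | hE
  · have := boltzmannConst_pos hβ hμ
    have := boltzmannConst_pos hβ hν
    rw [cutoffOcc_of_le hE, cutoffOcc_of_le hE, sub_zero, abs_zero]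
    positivity
  · rw [cutoffOcc_of_lt hE, cutoffOcc_of_lt hE]
    exact abs_occ_sub_occ_le hβ hμ hν hE.le

lemma continuousAt_cutoffOcc (hβ : 0 < β) (h : μ ≤ ε) (hE : E ≠ ε) :
    ContinuousAt (cutoffOcc β ε μ) E := by
  rcases hE.lt_or_gt with hlt | hgt
  · refine (continuousAt_const (y := (0 : ℝ))).congr ?_
    filter_upwards [Iio_mem_nhds hlt] with F hF using (cutoffOcc_of_le (le_of_lt hF)).symm
  · refine (continuousAt_occ hβ (h.trans_lt hgt)).congr ?_
    filter_upwards [Ioi_mem_nhds hgt] with F hF using (cutoffOcc_of_lt hF).symm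

lemma continuousAt_cutoffOcc_left (hβ : 0 < β) (h : μ < E) :
    ContinuousAt (fun μ => cutoffOcc β ε μ E) μ := by
  rcases le_or_gt E ε with hE | hE
  · simp only [cutoffOcc_of_le hE, continuousAt_const]
  · simp only [cutoffOcc_of_lt hE]
    exact continuousAt_occ_left hβ h

end CutoffOcc

section CutoffSum

variable {β ε μ ν ℓ : ℝ} {a : ℝ → ℕ → ℝ}

lemma abs_cutoffOcc_mul_le (hβ : 0 < β) (h : μ ≤ ε) (E : ℝ) {w : ℝ} (hw : |w| ≤ 1) :
    |cutoffOcc β ε μ E * w| ≤ cutoffOcc β ε μ E := by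
  have hnonneg := cutoffOcc_nonneg hβ h E
  rw [abs_mul, abs_of_nonneg hnonneg]
  exact mul_le_of_le_one_right hnonneg hw

lemma abs_cutoffOcc_mul_le_boltzmannConst_mul (hβ : 0 < β) (h : μ < ε) (E : ℝ) {w : ℝ}
    (hw : |w| ≤ 1) : |cutoffOcc β ε μ E * w| ≤ boltzmannConst β ε μ * exp (-β * E) :=
  (abs_cutoffOcc_mul_le hβ h.le E hw).trans (cutoffOcc_le_boltzmannConst_mul hβ h E)

lemma summable_cutoffOcc_mul (hβ : 0 < β) (h : μ < ε) (hℓ : 0 < ℓ) {w : ℕ → ℝ}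
    (hw : ∀ s, |w s| ≤ 1) : Summable (fun s : ℕ => cutoffOcc β ε μ (energy ℓ (s + 1)) * w s) :=
  summable_of_abs_le_exp_energy hβ hℓ
    fun s => abs_cutoffOcc_mul_le_boltzmannConst_mul hβ h _ (hw s)

lemma summable_cutoffOcc (hβ : 0 < β) (h : μ < ε) (hℓ : 0 < ℓ) :
    Summable (fun s : ℕ => cutoffOcc β ε μ (energy ℓ (s + 1))) := by
  simpa only [mul_one] using summable_cutoffOcc_mul hβ h hℓ (w := fun _ => 1) fun _ => abs_one.le

lemma summable_occ (hβ : 0 < β) (hℓ : 0 < ℓ) (hμ : μ < energy ℓ 1) :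
    Summable (fun s : ℕ => occ β μ (energy ℓ (s + 1))) :=
  summable_of_abs_le_exp_energy hβ hℓ fun s => by
    rw [abs_of_pos (occ_pos hβ (hμ.trans_le (energy_one_le ℓ s)))]
    exact occ_le_boltzmannConst_mul hβ hμ (energy_one_le ℓ s)

lemma measurable_cutoffSum (β ε μ : ℝ) (ha : ∀ s, Measurable (fun ℓ => a ℓ s)) :
    Measurable (cutoffSum β ε μ a) :=
  Measurable.tsum fun s =>
    ((measurable_cutoffOcc β ε μ).comp (measurable_energy (s + 1))).mul (ha s)

lemma abs_cutoffSum_le (hβ : 0 < β) (h : μ < ε) (hℓ : 0 < ℓ) (ha : ∀ s, |a ℓ s| ≤ 1) :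
    |cutoffSum β ε μ a ℓ| ≤ boltzmannConst β ε μ * (ℓ / √(2 * π * β)) :=
  abs_tsum_le_of_abs_le_exp_energy hβ hℓ
    fun s => abs_cutoffOcc_mul_le_boltzmannConst_mul hβ h _ (ha s)

lemma abs_cutoffSum_sub_le (hβ : 0 < β) (hμ : μ < ε) (hν : ν < ε) (hℓ : 0 < ℓ)
    (ha : ∀ s, |a ℓ s| ≤ 1) :
    |cutoffSum β ε μ a ℓ - cutoffSum β ε ν a ℓ| ≤ boltzmannConst β ε μ * boltzmannConst β ε ν *
      |exp (-(β * ν)) - exp (-(β * μ))| * (ℓ / √(2 * π * β)) := by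
  unfold cutoffSum
  rw [← (summable_cutoffOcc_mul hβ hμ hℓ ha).tsum_sub (summable_cutoffOcc_mul hβ hν hℓ ha)]
  refine abs_tsum_le_of_abs_le_exp_energy hβ hℓ fun s => ?_
  rw [← sub_mul, abs_mul]
  exact (mul_le_of_le_one_right (abs_nonneg _) (ha s)).trans (abs_cutoffOcc_sub_le hβ hμ hν _)

lemma continuousAt_cutoffSum (hβ : 0 < β) (h : μ < ε) (hℓ : 0 < ℓ)
    (ha : ∀ m, 0 < m → ∀ s, |a m s| ≤ 1) (hac : ∀ s, ContinuousAt (fun m => a m s) ℓ)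
    (hne : ∀ s : ℕ, energy ℓ (s + 1) ≠ ε) :
    ContinuousAt (cutoffSum β ε μ a) ℓ := by
  have hsum := (summable_exp_neg_mul_energy hβ (by positivity : 0 < 2 * ℓ)).mul_left
    (boltzmannConst β ε μ)
  refine tendsto_tsum_of_dominated_convergence hsum (fun s => ?_) ?_
  · exact ((continuousAt_cutoffOcc hβ h.le (hne s)).comp (f := fun m => energy m (s + 1))
      (continuousAt_energy hℓ.ne' (s + 1))).mul (hac s)
  · filter_upwards [Ioo_mem_nhds hℓ (by linarith : ℓ < 2 * ℓ)] with m ⟨hm, hmlt⟩ s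
    have hE : energy (2 * ℓ) (s + 1) ≤ energy m (s + 1) :=
      (strictAntiOn_energy s (mem_Ioi.2 hm) (mem_Ioi.2 (hm.trans hmlt)) hmlt).le
    refine (abs_cutoffOcc_mul_le_boltzmannConst_mul hβ h _ (ha m hm s)).trans ?_
    have := boltzmannConst_pos hβ h
    simp only [neg_mul]
    gcongr

lemma abs_cutoffOcc_mul_le_one_div_energy (hβ : 0 < β) (hε : 0 ≤ ε) (hμ : μ ≤ 0) (hℓ : 0 < ℓ)
    (s : ℕ) {w : ℝ} (hw : |w| ≤ 1) :
    |cutoffOcc β ε μ (energy ℓ (s + 1)) * w| ≤ 1 / β * (1 / energy ℓ (s + 1)) :=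
  (abs_cutoffOcc_mul_le hβ (hμ.trans hε) _ hw).trans
    (cutoffOcc_le_one_div hβ hμ (energy_pos hℓ s))

lemma abs_cutoffSum_le_sq (hβ : 0 < β) (hε : 0 ≤ ε) (hμ : μ ≤ 0) (hℓ : 0 < ℓ)
    (ha : ∀ s, |a ℓ s| ≤ 1) : |cutoffSum β ε μ a ℓ| ≤ 1 / β * (ℓ ^ 2 / 3) :=
  tsum_of_norm_bounded (f := fun s : ℕ => cutoffOcc β ε μ (energy ℓ (s + 1)) * a ℓ s)
    ((hasSum_one_div_energy ℓ).mul_left (1 / β))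
    fun s => abs_cutoffOcc_mul_le_one_div_energy hβ hε hμ hℓ s (ha s)

end CutoffSum

section LimCutoffDensity

variable {lam β ε μ ℓ : ℝ} {a : ℝ → ℕ → ℝ}

lemma integrableOn_exp_neg_mul_mul_sq (hlam : 0 < lam) (K : ℝ) :
    IntegrableOn (fun ℓ : ℝ => exp (-lam * ℓ) * (K * (ℓ ^ 2 / 3))) (Ioi 0) := by
  have := integrableOn_rpow_mul_exp_neg_mul_rpow (p := 1) (s := 2) (by norm_num) one_pos hlam
  refine (this.const_mul (K / 3)).congr (ae_of_all _ fun ℓ => ?_)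
  simp only [rpow_one, rpow_two]
  ring

lemma measurable_exp_neg_mul_mul_cutoffSum (lam β ε μ : ℝ)
    (ha : ∀ s, Measurable (fun ℓ => a ℓ s)) :
    Measurable (fun ℓ => exp (-lam * ℓ) * cutoffSum β ε μ a ℓ) :=
  Measurable.mul (by fun_prop) (measurable_cutoffSum β ε μ ha)

lemma norm_exp_neg_mul_mul_cutoffSum_le (lam : ℝ) (hβ : 0 < β) (hε : 0 ≤ ε) (hμ : μ ≤ 0)
    (hℓ : 0 < ℓ) (ha : ∀ s, |a ℓ s| ≤ 1) :
    ‖exp (-lam * ℓ) * cutoffSum β ε μ a ℓ‖ ≤ exp (-lam * ℓ) * (1 / β * (ℓ ^ 2 / 3)) := by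
  rw [norm_mul, norm_of_nonneg (exp_pos _).le]
  gcongr
  exact abs_cutoffSum_le_sq hβ hε hμ hℓ ha

lemma integrableOn_exp_neg_mul_mul_cutoffSum (hlam : 0 < lam) (hβ : 0 < β) (hε : 0 ≤ ε)
    (hμ : μ ≤ 0) (ham : ∀ s, Measurable (fun ℓ => a ℓ s)) (ha : ∀ m, 0 < m → ∀ s, |a m s| ≤ 1) :
    IntegrableOn (fun ℓ => exp (-lam * ℓ) * cutoffSum β ε μ a ℓ) (Ioi 0) :=
  (integrableOn_exp_neg_mul_mul_sq hlam (1 / β)).mono'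
    (measurable_exp_neg_mul_mul_cutoffSum lam β ε μ ham).aestronglyMeasurable <|
    (ae_restrict_mem measurableSet_Ioi).mono fun ℓ hℓ =>
      norm_exp_neg_mul_mul_cutoffSum_le lam hβ hε hμ hℓ (ha ℓ hℓ)

lemma tendsto_limCutoffDensity {ι : Type*} {F : Filter ι} [F.IsCountablyGenerated]
    (hlam : 0 < lam) (hβ : 0 < β) {e m : ι → ℝ} {w : ι → ℝ → ℕ → ℝ}
    (he : ∀ᶠ i in F, 0 ≤ e i) (hm : ∀ᶠ i in F, m i ≤ 0)
    (hwm : ∀ i s, Measurable (fun ℓ => w i ℓ s)) (hw : ∀ᶠ i in F, ∀ ℓ, 0 < ℓ → ∀ s, |w i ℓ s| ≤ 1)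
    (hlim : ∀ ℓ, 0 < ℓ → ∀ s : ℕ, Tendsto
      (fun i => cutoffOcc β (e i) (m i) (energy ℓ (s + 1)) * w i ℓ s) F
      (𝓝 (cutoffOcc β ε μ (energy ℓ (s + 1)) * a ℓ s))) :
    Tendsto (fun i => limCutoffDensity lam β (e i) (m i) (w i)) F
      (𝓝 (limCutoffDensity lam β ε μ a)) := by
  refine (tendsto_integral_filter_of_dominated_convergence
    (fun ℓ => exp (-lam * ℓ) * (1 / β * (ℓ ^ 2 / 3))) ?_ ?_
    (integrableOn_exp_neg_mul_mul_sq hlam _) ?_).const_mul _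
  · exact .of_forall fun i =>
      (measurable_exp_neg_mul_mul_cutoffSum lam β (e i) (m i) (hwm i)).aestronglyMeasurable
  · filter_upwards [he, hm, hw] with i hei hmi hwi
    filter_upwards [ae_restrict_mem measurableSet_Ioi] with ℓ hℓ
    exact norm_exp_neg_mul_mul_cutoffSum_le lam hβ hei hmi hℓ (hwi ℓ hℓ)
  · filter_upwards [ae_restrict_mem measurableSet_Ioi] with ℓ hℓ
    refine (tendsto_tsum_of_dominated_convergence
      ((hasSum_one_div_energy ℓ).mul_left (1 / β)).summable (hlim ℓ hℓ) ?_).const_mul _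
    filter_upwards [he, hm, hw] with i hei hmi hwi s
    exact abs_cutoffOcc_mul_le_one_div_energy hβ hei hmi hℓ s (hwi ℓ hℓ s)

end LimCutoffDensity

/-! ### Overlap of an eigenfunction with its translate -/

/-- The scalar product of the `s + 1`-st eigenfunction of an interval of length `ℓ` with its
translate by `d ≥ 0`, in closed form, see `integral_eigenfun_mul`. -/
def overlap (d ℓ : ℝ) (s : ℕ) : ℝ :=
  if d ≤ ℓ then (1 - d / ℓ) * cos (π * (s + 1) / ℓ * d) +
    sin (π * (s + 1) / ℓ * d) / (π * (s + 1)) else 0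

section Overlap

variable {d ℓ ε : ℝ}

lemma measurable_overlap (d : ℝ) (s : ℕ) : Measurable (fun ℓ => overlap d ℓ s) :=
  Measurable.ite measurableSet_Ici (by fun_prop) measurable_const

lemma abs_sin_div_le (hd : 0 ≤ d) (hℓ : 0 < ℓ) (s : ℕ) :
    |sin (π * (s + 1) / ℓ * d) / (π * (s + 1))| ≤ d / ℓ := by
  have hs : 0 < π * ((s : ℝ) + 1) := by positivity
  rw [abs_div, abs_of_pos hs, div_le_iff₀ hs]
  refine abs_sin_le_abs.trans_eq ?_
  rw [abs_of_nonneg (by positivity)]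
  ring

lemma abs_overlap_le_one (hd : 0 ≤ d) (hℓ : 0 < ℓ) (s : ℕ) : |overlap d ℓ s| ≤ 1 := by
  unfold overlap
  split_ifs with h
  · have hnonneg : 0 ≤ 1 - d / ℓ := sub_nonneg.2 ((div_le_one hℓ).2 h)
    have hcos : |(1 - d / ℓ) * cos (π * (s + 1) / ℓ * d)| ≤ 1 - d / ℓ := by
      rw [abs_mul, abs_of_nonneg hnonneg]
      exact mul_le_of_le_one_right hnonneg (abs_cos_le_one _)
    linarith [abs_add_le ((1 - d / ℓ) * cos (π * (s + 1) / ℓ * d))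
      (sin (π * (s + 1) / ℓ * d) / (π * (s + 1))), abs_sin_div_le hd hℓ s]
  · simp

lemma continuousAt_overlap (hℓ : ℓ ≠ 0) (hne : ℓ ≠ d) (s : ℕ) :
    ContinuousAt (fun m => overlap d m s) ℓ := by
  rcases hne.lt_or_gt with hlt | hgt
  · refine (continuousAt_const (y := (0 : ℝ))).congr ?_
    filter_upwards [Iio_mem_nhds hlt] with m hm
    rw [overlap, if_neg (not_le.2 hm)]
  · have hcont : ContinuousAt (fun m => (1 - d / m) * cos (π * (s + 1) / m * d) +
        sin (π * (s + 1) / m * d) / (π * (s + 1))) ℓ := by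
      fun_prop (disch := first | assumption | positivity)
    refine hcont.congr ?_
    filter_upwards [Ioi_mem_nhds hgt] with m hm
    rw [overlap, if_pos (le_of_lt hm)]

lemma one_div_le_sqrt_of_energy_le (s : ℕ) (hE : energy ℓ (s + 1) ≤ ε) :
    1 / ℓ ≤ √ε := by
  refine le_sqrt_of_sq_le (le_trans ?_ ((energy_one_le ℓ s).trans hE))
  calc (1 / ℓ) ^ 2 = 1 / 2 * (2 * 1 ^ 2 / ℓ ^ 2) := by ring
    _ ≤ 1 / 2 * (π ^ 2 * 1 ^ 2 / ℓ ^ 2) := by gcongr; nlinarith [pi_gt_three]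
    _ = energy ℓ 1 := by rw [energy, Nat.cast_one]

lemma abs_overlap_sub_one_le (hd : 0 ≤ d) (hℓ : 0 < ℓ) (s : ℕ) (hE : energy ℓ (s + 1) ≤ ε) :
    |overlap d ℓ s - 1| ≤ d ^ 2 * ε + 2 * d * √ε := by
  have hε : 0 < ε := (energy_pos hℓ s).trans_le hE
  have hdℓ : d / ℓ ≤ d * √ε := by
    rw [div_eq_mul_one_div]
    gcongr
    exact one_div_le_sqrt_of_energy_le s hE
  by_cases h : d ≤ ℓ
  · set k := π * (s + 1) / ℓ with hk
    have hkd : (k * d) ^ 2 / 2 ≤ d ^ 2 * ε := by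
      have : k ^ 2 / 2 = energy ℓ (s + 1) := by rw [hk, energy]; push_cast; field_simp
      nlinarith [sq_nonneg d]
    have hfrac : 0 ≤ d / ℓ := by positivity
    have hfrac' : 0 ≤ 1 - d / ℓ := sub_nonneg.2 ((div_le_one hℓ).2 h)
    have hsin := abs_le.1 (abs_sin_div_le hd hℓ s)
    rw [overlap, if_pos h, abs_le]
    constructor <;> nlinarith [hsin.1, hsin.2, one_sub_sq_div_two_le_cos (x := k * d),
      cos_le_one (k * d)]
  · have : 1 < d / ℓ := (one_lt_div hℓ).2 (not_le.1 h)
    have : 0 ≤ d ^ 2 * ε := by positivity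
    have : 0 ≤ d * √ε := by positivity
    rw [overlap, if_neg h, zero_sub, abs_neg, abs_one]
    linarith

end Overlap

/-! ### McDiarmid's inequality -/

section BoundedDifferences

open Function NNReal

lemma hasSubgaussianMGF_prod {α γ : Type*} [MeasurableSpace α] [MeasurableSpace γ]
    {κ : Measure α} {τ : Measure γ} [SFinite κ] [SFinite τ] {G : α × γ → ℝ} {H : γ → ℝ}
    {c₁ c₂ : ℝ≥0} (hG : Measurable G)
    (hGH : ∀ x, HasSubgaussianMGF (fun y => G (y, x) - H x) c₁ κ)
    (hH : HasSubgaussianMGF H c₂ τ) : HasSubgaussianMGF G (c₁ + c₂) (κ.prod τ) := by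
  have hsplit (t : ℝ) (x : γ) :
      (fun y => exp (t * G (y, x))) = fun y => exp (t * (G (y, x) - H x)) * exp (t * H x) := by
    funext y
    rw [← exp_add]
    ring_nf
  have hinner (t : ℝ) (x : γ) :
      ∫ y, exp (t * G (y, x)) ∂κ ≤ exp (c₁ * t ^ 2 / 2) * exp (t * H x) := by
    rw [hsplit, integral_mul_const]
    gcongr
    exact (hGH x).mgf_le t
  have hint (t : ℝ) : Integrable (fun p => exp (t * G p)) (κ.prod τ) := by
    refine (integrable_prod_iff' (by fun_prop)).2 ⟨ae_of_all _ fun x => ?_, ?_⟩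
    · rw [hsplit]
      exact ((hGH x).integrable_exp_mul t).mul_const _
    · simp only [norm_of_nonneg (exp_pos _).le]
      refine ((hH.integrable_exp_mul t).const_mul (exp (c₁ * t ^ 2 / 2))).mono'
        ((hG.const_mul t).exp.stronglyMeasurable.integral_prod_left' (μ := κ)).aestronglyMeasurable
        (ae_of_all _ fun x => ?_)
      rw [norm_of_nonneg (integral_nonneg fun y => (exp_pos _).le)]
      exact hinner t x
  refine ⟨hint, fun t => ?_⟩
  calc ∫ p, exp (t * G p) ∂(κ.prod τ)
      = ∫ x, ∫ y, exp (t * G (y, x)) ∂κ ∂τ := integral_prod_symm _ (hint t)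
    _ ≤ ∫ x, exp (c₁ * t ^ 2 / 2) * exp (t * H x) ∂τ :=
        integral_mono (hint t).integral_prod_right ((hH.integrable_exp_mul t).const_mul _)
          (hinner t)
    _ = exp (c₁ * t ^ 2 / 2) * mgf H τ t := integral_const_mul _ _
    _ ≤ exp (c₁ * t ^ 2 / 2) * exp (c₂ * t ^ 2 / 2) := by
        gcongr
        exact hH.mgf_le t
    _ = exp ((c₁ + c₂ : ℝ≥0) * t ^ 2 / 2) := by
        rw [← exp_add, NNReal.coe_add]
        ring_nf

lemma abs_sub_le_sum_of_bounded_differences {ι : Type*} [Fintype ι] [DecidableEq ι]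
    {α : ι → Type*} {F : (∀ i, α i) → ℝ} {c : ι → ℝ}
    (hF : ∀ x i y, |F (update x i y) - F x| ≤ c i) (x y : ∀ i, α i) :
    |F x - F y| ≤ ∑ i, c i := by
  suffices h : ∀ s : Finset ι, |F (s.piecewise x y) - F y| ≤ ∑ i ∈ s, c i by
    simpa only [Finset.piecewise_univ] using h Finset.univ
  intro s
  induction s using Finset.induction_on with
  | empty => simp
  | insert i s hi ih =>
    rw [Finset.piecewise_insert, Finset.sum_insert hi]
    exact (abs_sub_le _ _ _).trans (add_le_add (hF _ _ _) ih)

lemma hasSubgaussianMGF_sub_integral_of_abs_sub_le {α : Type*} [MeasurableSpace α]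
    {κ : Measure α} [IsProbabilityMeasure κ] {f : α → ℝ} (hf : Measurable f) (c : ℝ≥0)
    (hc : ∀ x y, |f x - f y| ≤ c) :
    HasSubgaussianMGF (fun x => f x - ∫ y, f y ∂κ) (c ^ 2) κ := by
  obtain ⟨y₀⟩ : Nonempty α := nonempty_of_isProbabilityMeasure κ
  have hmem (y : α) : f y ∈ Icc (f y₀ - c) (f y₀ + c) := by
    have := abs_le.1 (hc y y₀)
    constructor <;> linarith
  have h := hasSubgaussianMGF_of_mem_Icc hf.aemeasurable (ae_of_all κ hmem)
  convert h using 2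
  ext
  rw [NNReal.coe_div, coe_nnnorm, norm_of_nonneg (by linarith [c.coe_nonneg])]
  simp

lemma integrable_of_abs_sub_le {α : Type*} [MeasurableSpace α] {κ : Measure α}
    [IsFiniteMeasure κ] {f : α → ℝ} (hf : Measurable f) {C : ℝ} (hC : ∀ x y, |f x - f y| ≤ C) :
    Integrable f κ := by
  rcases isEmpty_or_nonempty α with _ | ⟨⟨y⟩⟩
  · rw [Measure.eq_zero_of_isEmpty κ]
    exact integrable_zero_measure
  · refine .of_bound hf.aestronglyMeasurable (|f y| + C) (ae_of_all _ fun x => ?_)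
    linarith [hC x y, abs_sub_abs_le_abs_sub (f x) (f y), norm_eq_abs (f x)]

lemma hasSubgaussianMGF_prod_sub_integral {α γ : Type*} [MeasurableSpace α] [MeasurableSpace γ]
    {κ : Measure α} [IsProbabilityMeasure κ] {τ : Measure γ} [SFinite τ] {G : α × γ → ℝ}
    (hG : Measurable G) (hGint : Integrable G (κ.prod τ)) {c₁ c₂ : ℝ≥0}
    (hc : ∀ x y z, |G (y, x) - G (z, x)| ≤ c₁)
    (hG₂ : HasSubgaussianMGF (fun x => ∫ y, G (y, x) ∂κ - ∫ z, ∫ y, G (y, z) ∂κ ∂τ) c₂ τ) :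
    HasSubgaussianMGF (fun p => G p - ∫ q, G q ∂κ.prod τ) (c₁ ^ 2 + c₂) (κ.prod τ) := by
  rw [integral_prod_symm G hGint]
  refine hasSubgaussianMGF_prod (hG.sub_const _) (fun x => ?_) hG₂
  simpa only [sub_sub_sub_cancel_right, comp_apply] using
    hasSubgaussianMGF_sub_integral_of_abs_sub_le (hG.comp measurable_prodMk_right) c₁ (hc x)

lemma hasSubgaussianMGF_pi_of_bounded_differences {N : ℕ} {α : Fin N → Type*}
    [∀ i, MeasurableSpace (α i)] (κ : ∀ i, Measure (α i)) [∀ i, IsProbabilityMeasure (κ i)]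
    {F : (∀ i, α i) → ℝ} (hF : Measurable F) (c : Fin N → ℝ≥0)
    (hc : ∀ x i y, |F (update x i y) - F x| ≤ c i) :
    HasSubgaussianMGF (fun x => F x - ∫ y, F y ∂Measure.pi κ) (∑ i, c i ^ 2)
      (Measure.pi κ) := by
  induction N with
  | zero =>
    have hconst : F = fun _ => F default := funext fun x => congrArg F (Subsingleton.elim _ _)
    rw [hconst]
    simp
  | succ N ih =>
    set τ := Measure.pi fun j => κ (Fin.succAbove 0 j)
    set e := MeasurableEquiv.piFinSuccAbove α 0
    have he : MeasurePreserving e (Measure.pi κ) ((κ 0).prod τ) :=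
      measurePreserving_piFinSuccAbove κ 0
    set G : α 0 × (∀ j, α (Fin.succAbove 0 j)) → ℝ := fun p => F (e.symm p)
    have hG : Measurable G := hF.comp e.symm.measurable
    have hGF (x : ∀ i, α i) : G (e x) = F x := congrArg F (e.symm_apply_apply x)
    have hG₁ (x y z) : |G (y, x) - G (z, x)| ≤ c 0 := by
      have h := hc (Fin.insertNth 0 z x) 0 y
      rwa [Fin.update_insertNth] at h
    have hG₂ (y x i z) : |G (y, update x i z) - G (y, x)| ≤ c (Fin.succAbove 0 i) := by
      have h := hc (Fin.insertNth 0 y x) (Fin.succAbove 0 i) z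
      rwa [← Fin.insertNth_update] at h
    have hosc (p q) : |G p - G q| ≤ ∑ i, (c i : ℝ) := abs_sub_le_sum_of_bounded_differences hc _ _
    have hsection (x) : Integrable (fun y => G (y, x)) (κ 0) :=
      integrable_of_abs_sub_le (hG.comp measurable_prodMk_right) (hG₁ x)
    have hmeanG (x i z) :
        |∫ y, G (y, update x i z) ∂κ 0 - ∫ y, G (y, x) ∂κ 0| ≤ c (Fin.succAbove 0 i) := by
      rw [← integral_sub (hsection _) (hsection _)]
      simpa using norm_integral_le_of_norm_le_const (μ := κ 0)
        (f := fun y => G (y, update x i z) - G (y, x)) (ae_of_all _ fun y => hG₂ y x i z)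
    have hprod := hasSubgaussianMGF_prod_sub_integral hG (integrable_of_abs_sub_le hG hosc) hG₁
      (ih (fun j => κ (Fin.succAbove 0 j))
        (hG.stronglyMeasurable.integral_prod_left' (μ := κ 0)).measurable _ hmeanG)
    rw [← he.integral_comp' (g := G), ← he.map_eq] at hprod
    rw [Fin.sum_univ_succAbove _ 0]
    simpa only [comp_def, hGF] using HasSubgaussianMGF.of_map he.aemeasurable hprod

lemma measure_abs_sub_integral_ge_le_of_bounded_differences {N : ℕ} {α : Fin N → Type*}
    [∀ i, MeasurableSpace (α i)] (κ : ∀ i, Measure (α i)) [∀ i, IsProbabilityMeasure (κ i)]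
    {F : (∀ i, α i) → ℝ} (hF : Measurable F) (c : Fin N → ℝ≥0)
    (hc : ∀ x i y, |F (update x i y) - F x| ≤ c i) {η : ℝ} (hη : 0 ≤ η) :
    (Measure.pi κ).real {x | η ≤ |F x - ∫ y, F y ∂Measure.pi κ|} ≤
      2 * exp (-η ^ 2 / (2 * ∑ i, (c i : ℝ) ^ 2)) := by
  have h := hasSubgaussianMGF_pi_of_bounded_differences κ hF c hc
  have hupper := h.measure_ge_le hη
  have hlower := h.neg.measure_ge_le hη
  push_cast at hupper hlower
  rw [two_mul]
  refine (measureReal_mono fun x hx => ?_).trans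
    ((measureReal_union_le _ _).trans (add_le_add hupper hlower))
  exact le_abs.1 (by simpa using hx)

end BoundedDifferences

/-! ### Geometry of the partition -/

section Partition

variable {N : ℕ} {L : ℝ} {x : Fin N → ℝ}

lemma left_zero : left L x 0 = -L / 2 := rfl

lemma left_succ (i : Fin N) : left L x i.succ = x (Tuple.sort x i) := by
  rw [left, ← Fin.succ_castSucc, node, Fin.cons_succ, Fin.snoc_castSucc, Function.comp_apply]

lemma right_castSucc (i : Fin N) : right L x i.castSucc = x (Tuple.sort x i) := by
  rw [right, node, Fin.cons_succ, Fin.snoc_castSucc, Function.comp_apply]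

lemma right_last : right L x (Fin.last N) = L / 2 := by
  rw [right, node, Fin.cons_succ, Fin.snoc_last]

lemma gap_pos_of_injective (hL : 0 < L) (hinj : Function.Injective x)
    (hbox : ∀ i, x i ∈ Ioo (-L / 2) (L / 2)) (j : Fin (N + 1)) : 0 < gap L x j := by
  have hmono : StrictMono (x ∘ Tuple.sort x) :=
    (Tuple.monotone_sort x).strictMono_of_injective (hinj.comp (Tuple.sort x).injective)
  rw [gap, sub_pos]
  rcases j.eq_castSucc_or_eq_last with ⟨k, rfl⟩ | rfl
  · rw [right_castSucc]
    rcases k.castSucc.eq_zero_or_eq_succ with hk | ⟨i, hk⟩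
    · rw [hk, left_zero]
      exact (hbox _).1
    · rw [hk, left_succ]
      exact hmono (Fin.castSucc_lt_castSucc_iff.1 (hk ▸ Fin.castSucc_lt_succ))
  · rw [right_last]
    rcases (Fin.last N).eq_zero_or_eq_succ with hk | ⟨i, hk⟩
    · rw [hk, left_zero]
      linarith
    · rw [hk, left_succ]
      exact (hbox _).2

lemma sum_gap : ∑ j, gap L x j = L := by
  have hsucc := Fin.sum_univ_succ (node L x)
  have hcast := Fin.sum_univ_castSucc (node L x)
  have hlast : node L x (Fin.last (N + 1)) = L / 2 := right_last
  have hzero : node L x 0 = -L / 2 := rfl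
  simp only [gap, left, right, Finset.sum_sub_distrib]
  linarith

lemma monotone_node (hg : ∀ j, 0 ≤ gap L x j) : Monotone (node L x) :=
  Fin.monotone_iff_le_succ.2 fun j => sub_nonneg.1 (hg j)

lemma neg_half_le_left (hg : ∀ j, 0 ≤ gap L x j) (j : Fin (N + 1)) : -L / 2 ≤ left L x j :=
  monotone_node hg (Fin.zero_le _)

lemma right_le_half (hg : ∀ j, 0 ≤ gap L x j) (j : Fin (N + 1)) : right L x j ≤ L / 2 :=
  right_last (x := x) ▸ monotone_node hg (Fin.le_last _)

lemma right_le_left (hg : ∀ j, 0 ≤ gap L x j) {j k : Fin (N + 1)} (h : j < k) :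
    right L x j ≤ left L x k :=
  monotone_node hg (Fin.castSucc_lt_iff_succ_le.1 (Fin.castSucc_lt_castSucc_iff.2 h))

lemma exists_mem_Ico_left_right {z : ℝ} (hz : z ∈ Ico (-L / 2) (L / 2)) :
    ∃ j, z ∈ Ico (left L x j) (right L x j) := by
  by_contra! h
  have hle (k : Fin (N + 2)) : node L x k ≤ z := by
    induction k using Fin.induction with
    | zero => exact hz.1
    | succ i ih => exact not_lt.1 fun hi => h i ⟨ih, hi⟩
  exact hz.2.not_ge ((right_last (x := x)).ge.trans (hle (Fin.last (N + 1))))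

lemma notMem_Ioo_left_right (hg : ∀ j, 0 ≤ gap L x j) (i : Fin N) (j : Fin (N + 1)) :
    x i ∉ Ioo (left L x j) (right L x j) := by
  obtain ⟨k, rfl⟩ := (Tuple.sort x).surjective i
  rintro ⟨hl, hr⟩
  rcases le_or_gt j k.castSucc with h | h
  · exact hr.not_ge ((monotone_node hg (Fin.succ_le_succ_iff.2 h)).trans_eq (right_castSucc k))
  · exact hl.not_ge ((right_castSucc k).ge.trans (right_le_left hg h))

lemma right_eq_half_or_exists_eq (j : Fin (N + 1)) :
    right L x j = L / 2 ∨ ∃ i, right L x j = x i := by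
  rcases j.eq_castSucc_or_eq_last with ⟨k, rfl⟩ | rfl
  · exact Or.inr ⟨_, right_castSucc k⟩
  · exact Or.inl right_last

end Partition

/-! ### Windows without impurities -/

/-- The left end-points of the windows of length `t` in `[-L/2, L/2]` which contain no impurity.
The mean of its length `∑ⱼ max (ℓⱼ - t) 0` can be computed without ordering the impurities. -/
def emptyWindows {N : ℕ} (L t : ℝ) (x : Fin N → ℝ) : Set ℝ :=
  {z | z ∈ Icc (-L / 2) (L / 2 - t) ∧ ∀ i, x i ∉ Ioo z (z + t)}

section EmptyWindows

variable {N : ℕ} {L t : ℝ}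

lemma emptyWindows_eq_iUnion {x : Fin N → ℝ} (ht : 0 < t) (hg : ∀ j, 0 ≤ gap L x j) :
    emptyWindows L t x = ⋃ j, Icc (left L x j) (right L x j - t) := by
  ext z
  rw [mem_iUnion]
  constructor
  · rintro ⟨⟨hlz, hzr⟩, hempty⟩
    obtain ⟨j, hj⟩ := exists_mem_Ico_left_right (x := x) ⟨hlz, by linarith⟩
    refine ⟨j, hj.1, ?_⟩
    rcases right_eq_half_or_exists_eq (L := L) (x := x) j with h | ⟨i, h⟩
    · exact h ▸ hzr
    · rw [le_sub_iff_add_le, h]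
      exact not_lt.1 fun hlt => hempty i ⟨h ▸ hj.2, hlt⟩
  · rintro ⟨j, hlz, hzr⟩
    exact ⟨⟨(neg_half_le_left hg j).trans hlz, by linarith [right_le_half hg j]⟩,
      fun i hi => notMem_Ioo_left_right hg i j ⟨hlz.trans_lt hi.1, by linarith [hi.2]⟩⟩

lemma volume_emptyWindows {x : Fin N → ℝ} (ht : 0 < t) (hg : ∀ j, 0 ≤ gap L x j) :
    volume.real (emptyWindows L t x) = ∑ j, max (gap L x j - t) 0 := by
  have hdisj : Pairwise (Function.onFun Disjoint fun j => Icc (left L x j) (right L x j - t)) := by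
    refine (pairwise_disjoint_on _).2 fun j k hjk => disjoint_left.2 ?_
    rintro z ⟨_, hj⟩ ⟨hk, _⟩
    linarith [right_le_left hg hjk]
  rw [emptyWindows_eq_iUnion ht hg, measureReal_iUnion_fintype hdisj (fun _ => measurableSet_Icc)
    fun _ => measure_Icc_lt_top.ne]
  simp only [Real.volume_real_Icc, gap, sub_right_comm]

lemma volume_emptyWindows_ne_top (x : Fin N → ℝ) : volume (emptyWindows L t x) ≠ ⊤ :=
  measure_ne_top_of_subset (fun _ hz => hz.1) measure_Icc_lt_top.ne

lemma volume_emptyWindows_le_update (ht : 0 ≤ t) (x : Fin N → ℝ) (i : Fin N) (y : ℝ) :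
    volume.real (emptyWindows L t x) ≤
      volume.real (emptyWindows L t (Function.update x i y)) + t := by
  have hsub : emptyWindows L t x ⊆
      emptyWindows L t (Function.update x i y) ∪ Icc (y - t) y := by
    rintro z ⟨hz, hempty⟩
    by_cases hy : y ∈ Ioo z (z + t)
    · exact Or.inr ⟨by linarith [hy.2], hy.1.le⟩
    · refine Or.inl ⟨hz, fun k => ?_⟩
      rcases eq_or_ne k i with rfl | hk
      · rwa [Function.update_self]
      · rw [Function.update_of_ne hk]
        exact hempty k
  calc volume.real (emptyWindows L t x)
      ≤ volume.real (emptyWindows L t (Function.update x i y) ∪ Icc (y - t) y) :=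
        measureReal_mono hsub
          (measure_union_ne_top (volume_emptyWindows_ne_top _) measure_Icc_lt_top.ne)
    _ ≤ volume.real (emptyWindows L t (Function.update x i y)) + volume.real (Icc (y - t) y) :=
        measureReal_union_le _ _
    _ = volume.real (emptyWindows L t (Function.update x i y)) + t := by
        rw [Real.volume_real_Icc_of_le (by linarith), sub_sub_cancel]

lemma abs_volume_emptyWindows_update_sub_le (ht : 0 ≤ t) (x : Fin N → ℝ) (i : Fin N) (y : ℝ) :
    |volume.real (emptyWindows L t (Function.update x i y)) - volume.real (emptyWindows L t x)|
      ≤ t := by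
  have hle := volume_emptyWindows_le_update (L := L) ht x i y
  have hge := volume_emptyWindows_le_update (L := L) ht (Function.update x i y) i (x i)
  rw [Function.update_idem, Function.update_eq_self] at hge
  exact abs_sub_le_iff.2 ⟨by linarith, by linarith⟩

lemma measurableSet_notMem_Ioo_add (N : ℕ) (t : ℝ) :
    MeasurableSet {p : (Fin N → ℝ) × ℝ | ∀ i, p.1 i ∉ Ioo p.2 (p.2 + t)} := by
  have hset : {p : (Fin N → ℝ) × ℝ | ∀ i, p.1 i ∉ Ioo p.2 (p.2 + t)} =
      ⋂ i, ({p | p.2 < p.1 i} ∩ {p | p.1 i < p.2 + t})ᶜ := by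
    ext p
    simp only [mem_iInter, mem_compl_iff]
    rfl
  rw [hset]
  exact .iInter fun i => .compl <| .inter (measurableSet_lt (by fun_prop) (by fun_prop))
    (measurableSet_lt (by fun_prop) (by fun_prop))

lemma volume_emptyWindows_eq_restrict (x : Fin N → ℝ) :
    volume.real (emptyWindows L t x) =
      (volume.restrict (Icc (-L / 2) (L / 2 - t))).real {z | ∀ i, x i ∉ Ioo z (z + t)} := by
  rw [measureReal_restrict_apply' measurableSet_Icc, inter_comm]
  rfl

lemma measurable_volume_emptyWindows :
    Measurable (fun x : Fin N → ℝ => volume.real (emptyWindows L t x)) := by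
  simp only [volume_emptyWindows_eq_restrict]
  exact (measurable_measure_prodMk_left (measurableSet_notMem_Ioo_add N t)).ennreal_toReal

lemma isProbabilityMeasure_cond_Icc {a b : ℝ} (hab : a < b) :
    IsProbabilityMeasure (ProbabilityTheory.cond volume (Icc a b)) :=
  cond_isProbabilityMeasure_of_finite (by simpa using hab) measure_Icc_lt_top.ne

lemma cond_Icc_real_Ioo {a b c d : ℝ} (hab : a ≤ b) (hcd : c ≤ d)
    (h : Ioo c d ⊆ Icc a b) :
    (ProbabilityTheory.cond volume (Icc a b)).real (Ioo c d) = (d - c) / (b - a) := by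
  rw [measureReal_def, cond_apply measurableSet_Icc, inter_eq_right.2 h, ENNReal.toReal_mul,
    ENNReal.toReal_inv, ← measureReal_def, ← measureReal_def, Real.volume_real_Icc_of_le hab,
    Real.volume_real_Ioo_of_le hcd, inv_mul_eq_div]

lemma integral_measureReal_section_comm {α γ : Type*} [MeasurableSpace α] [MeasurableSpace γ]
    (κ : Measure α) [IsFiniteMeasure κ] (τ : Measure γ) [IsFiniteMeasure τ] {S : Set (α × γ)}
    (hS : MeasurableSet S) :
    ∫ x, τ.real {y | (x, y) ∈ S} ∂κ = ∫ y, κ.real {x | (x, y) ∈ S} ∂τ := by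
  have h := integral_integral_swap (f := fun x y => S.indicator (fun _ => (1 : ℝ)) (x, y))
    ((integrable_const (μ := κ.prod τ) (1 : ℝ)).indicator hS)
  convert h using 3 with x y
  · exact (integral_indicator_one (measurable_prodMk_left hS)).symm
  · exact (integral_indicator_one (measurable_prodMk_right hS)).symm

lemma pi_cond_real_notMem_Ioo_add (ht : 0 ≤ t) (hL : 0 < L) {z : ℝ}
    (hz : z ∈ Icc (-L / 2) (L / 2 - t)) :
    (Measure.pi fun _ : Fin N => ProbabilityTheory.cond volume (Icc (-L / 2) (L / 2))).real
      {x | ∀ i, x i ∉ Ioo z (z + t)} = (1 - t / L) ^ N := by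
  have hbox : -L / 2 < L / 2 := by linarith
  have := isProbabilityMeasure_cond_Icc hbox
  have hsub : Ioo z (z + t) ⊆ Icc (-L / 2) (L / 2) := fun w hw =>
    ⟨hz.1.trans hw.1.le, by linarith [hz.2, hw.2]⟩
  have hset : {x : Fin N → ℝ | ∀ i, x i ∉ Ioo z (z + t)} =
      Set.pi univ fun _ => (Ioo z (z + t))ᶜ := by
    ext x
    simp
  rw [hset, measureReal_def, Measure.pi_pi, ENNReal.toReal_prod]
  simp only [← measureReal_def, probReal_compl_eq_one_sub measurableSet_Ioo,
    cond_Icc_real_Ioo hbox.le (le_add_of_nonneg_right ht) hsub, Finset.prod_const, Finset.card_univ,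
    Fintype.card_fin]
  ring_nf

lemma integral_volume_emptyWindows (ht : 0 ≤ t) (hL : 0 < L) (htL : t ≤ L) :
    ∫ x : Fin N → ℝ, volume.real (emptyWindows L t x)
        ∂(Measure.pi fun _ => ProbabilityTheory.cond volume (Icc (-L / 2) (L / 2))) =
      (L - t) * (1 - t / L) ^ N := by
  have := isProbabilityMeasure_cond_Icc (show -L / 2 < L / 2 by linarith)
  simp only [volume_emptyWindows_eq_restrict]
  have hswap := integral_measureReal_section_comm
    (Measure.pi fun _ : Fin N => ProbabilityTheory.cond volume (Icc (-L / 2) (L / 2)))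
    (volume.restrict (Icc (-L / 2) (L / 2 - t))) (measurableSet_notMem_Ioo_add N t)
  simp only [mem_ofPred_eq] at hswap
  rw [hswap, setIntegral_congr_fun measurableSet_Icc
    fun z hz => pi_cond_real_notMem_Ioo_add ht hL hz, setIntegral_const,
    Real.volume_real_Icc_of_le (by linarith), smul_eq_mul]
  ring

end EmptyWindows

section ThermodynamicLimit

variable {lam : ℝ} {L : ℕ → ℝ}

lemma tendsto_length_atTop (hL : ∀ N, 0 < L N)
    (hLlam : Tendsto (fun N : ℕ => ((N : ℝ) + 1) / L N) atTop (𝓝 lam)) : Tendsto L atTop atTop := by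
  have hinv : Tendsto (fun N => (L N)⁻¹) atTop (𝓝[>] 0) := by
    refine tendsto_nhdsWithin_iff.2 ⟨?_, .of_forall fun N => inv_pos.2 (hL N)⟩
    have h := hLlam.mul tendsto_one_div_add_atTop_nhds_zero_nat
    rw [mul_zero] at h
    exact h.congr fun N => by field_simp
  exact hinv.inv_tendsto_nhdsGT_zero.congr fun N => inv_inv (L N)

lemma summable_exp_neg_mul_sq_div (hL : ∀ N, 0 < L N)
    (hLlam : Tendsto (fun N : ℕ => ((N : ℝ) + 1) / L N) atTop (𝓝 lam)) {a : ℝ} (ha : 0 < a) :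
    Summable fun N : ℕ => exp (-(a * L N ^ 2 / N)) := by
  have hlam : 0 ≤ lam := ge_of_tendsto' hLlam fun N => by have := hL N; positivity
  have hgeom : Summable fun N : ℕ => exp (N * (-(a / (lam + 1) ^ 2))) :=
    Real.summable_exp_nat_mul_iff.2 (neg_lt_zero.2 (by positivity))
  refine summable_of_isBigO_nat hgeom (Asymptotics.IsBigO.of_bound 1 ?_)
  filter_upwards [hLlam.eventually_lt_const (lt_add_one lam), eventually_gt_atTop 0] with N hN hN0
  have hN0' : (0 : ℝ) < N := by exact_mod_cast hN0
  have hle : (N : ℝ) ≤ (lam + 1) * L N := by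
    rw [div_lt_iff₀ (hL N)] at hN
    linarith
  rw [norm_of_nonneg (exp_pos _).le, norm_of_nonneg (exp_pos _).le, one_mul, exp_le_exp,
    mul_neg, neg_le_neg_iff, le_div_iff₀ hN0']
  calc N * (a / (lam + 1) ^ 2) * N = a * ((N : ℝ) ^ 2 / (lam + 1) ^ 2) := by ring
    _ ≤ a * (((lam + 1) * L N) ^ 2 / (lam + 1) ^ 2) := by gcongr
    _ = a * L N ^ 2 := by field_simp

lemma tendsto_mean_emptyWindows (hL : ∀ N, 0 < L N)
    (hLlam : Tendsto (fun N : ℕ => ((N : ℝ) + 1) / L N) atTop (𝓝 lam)) (t : ℝ) :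
    Tendsto (fun N => 1 / L N * ((L N - t) * (1 - t / L N) ^ N)) atTop (𝓝 (exp (-(lam * t)))) := by
  have hinv : Tendsto (fun N => (L N)⁻¹) atTop (𝓝 0) :=
    tendsto_inv_atTop_zero.comp (tendsto_length_atTop hL hLlam)
  have hexponent : Tendsto (fun N : ℕ => (N : ℝ) * (-(t / L N))) atTop (𝓝 (-(lam * t))) := by
    have h := ((hLlam.sub hinv).mul_const t).neg
    rw [sub_zero] at h
    exact h.congr fun N => by ring
  have hfactor : Tendsto (fun N => 1 - t * (L N)⁻¹) atTop (𝓝 1) := by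
    simpa using (hinv.const_mul t).const_sub 1
  have h := hfactor.mul (Real.tendsto_one_add_pow_exp_of_tendsto hexponent)
  rw [one_mul] at h
  refine h.congr fun N => ?_
  have := (hL N).ne'
  field_simp
  ring

end ThermodynamicLimit

/-! ### Almost sure statements about the impurities -/

section Probability

variable {Ω : Type*} [MeasurableSpace Ω] {P : Measure Ω}

lemma ae_tendsto_zero_of_summable_measureReal [IsFiniteMeasure P] {Y : ℕ → Ω → ℝ}
    (hY : ∀ η > 0, Summable fun N => P.real {ω | η ≤ |Y N ω|}) :
    ∀ᵐ ω ∂P, Tendsto (fun N => Y N ω) atTop (𝓝 0) := by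
  have hsmall (η : ℝ) (hη : 0 < η) : ∀ᵐ ω ∂P, ∀ᶠ N in atTop, |Y N ω| < η := by
    have hne : ∑' N, P {ω | η ≤ |Y N ω|} ≠ ⊤ := by
      rw [← tsum_congr fun N => ofReal_measureReal (μ := P) (s := {ω | η ≤ |Y N ω|})]
      exact (hY η hη).tsum_ofReal_ne_top
    filter_upwards [ae_eventually_notMem hne] with ω hω
    exact hω.mono fun N hN => not_le.1 hN
  have hsmall' : ∀ᵐ ω ∂P, ∀ k : ℕ, ∀ᶠ N in atTop, |Y N ω| < 1 / ((k : ℝ) + 1) :=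
    ae_all_iff.2 fun k => hsmall _ (by positivity)
  filter_upwards [hsmall'] with ω hω
  refine Metric.tendsto_nhds.2 fun η hη => ?_
  obtain ⟨k, hk⟩ := exists_nat_one_div_lt hη
  filter_upwards [hω k] with N hN
  rw [dist_zero_right]
  exact hN.trans hk

lemma ae_ne_of_indepFun [IsFiniteMeasure P] {X Y : Ω → ℝ} (hX : Measurable X)
    (hY : Measurable Y) [NullSingletonClass (P.map Y)] (hXY : IndepFun X Y P) :
    ∀ᵐ ω ∂P, X ω ≠ Y ω := by
  have hdiag : ∀ᵐ p ∂(P.map X).prod (P.map Y), p.1 ≠ p.2 := by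
    refine Measure.ae_prod_iff_ae_ae ?_ |>.2 (.of_forall fun x => ?_)
    · exact (measurableSet_eq_fun measurable_fst measurable_snd).compl
    · filter_upwards [measure_eq_zero_iff_ae_notMem.1 (measure_singleton (μ := P.map Y) x)]
        with y hy using Ne.symm hy
  rw [← (indepFun_iff_map_prod_eq_prod_map_map hX.aemeasurable hY.aemeasurable).1 hXY] at hdiag
  exact ae_of_ae_map (hX.prodMk hY).aemeasurable hdiag

lemma ae_mem_Ioo_of_isUniform {X : Ω → ℝ} (hX : Measurable X) {a b : ℝ}
    (hunif : pdf.IsUniform X (Icc a b) P volume) : ∀ᵐ ω ∂P, X ω ∈ Ioo a b := by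
  refine ae_of_ae_map hX.aemeasurable ?_
  rw [hunif]
  have hends : ∀ᵐ y ∂ProbabilityTheory.cond volume (Icc a b), y ∉ ({a, b} : Set ℝ) :=
    cond_absolutelyContinuous.ae_le
      (measure_eq_zero_iff_ae_notMem.1 ((Set.toFinite {a, b}).measure_zero volume))
  filter_upwards [ae_cond_mem measurableSet_Icc, hends] with y hy hne
  exact Icc_sdiff_both (a := a) (b := b) ▸ ⟨hy, hne⟩

section

variable [IsProbabilityMeasure P] {N : ℕ} {L : ℝ} {X : Fin N → Ω → ℝ}

lemma map_eq_pi_cond_of_isUniform (hXmeas : ∀ i, Measurable (X i)) {S : Fin N → Set ℝ}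
    (hXunif : ∀ i, pdf.IsUniform (X i) (S i) P volume) (hXindep : iIndepFun X P) :
    P.map (fun ω i => X i ω) = Measure.pi fun i => ProbabilityTheory.cond volume (S i) := by
  rw [(iIndepFun_iff_map_fun_eq_pi_map fun i => (hXmeas i).aemeasurable).1 hXindep]
  exact congrArg Measure.pi (funext hXunif)

lemma measureReal_abs_emptyWindows_sub_ge_le (hXmeas : ∀ i, Measurable (X i))
    (hXunif : ∀ i, pdf.IsUniform (X i) (Icc (-L / 2) (L / 2)) P volume) (hXindep : iIndepFun X P)
    {t : ℝ} (ht : 0 ≤ t) (hL : 0 < L) (htL : t ≤ L) {η : ℝ} (hη : 0 ≤ η) :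
    P.real {ω | η ≤ |1 / L * volume.real (emptyWindows L t fun i => X i ω) -
        1 / L * ((L - t) * (1 - t / L) ^ N)|} ≤ 2 * exp (-(η ^ 2 / (2 * t ^ 2) * L ^ 2 / N)) := by
  lift t to NNReal using ht
  have := isProbabilityMeasure_cond_Icc (show -L / 2 < L / 2 by linarith)
  have hconc := measure_abs_sub_integral_ge_le_of_bounded_differences
    (fun _ : Fin N => ProbabilityTheory.cond volume (Icc (-L / 2) (L / 2)))
    (measurable_volume_emptyWindows (L := L) (t := t)) (fun _ => t)
    (abs_volume_emptyWindows_update_sub_le t.coe_nonneg) (mul_nonneg hη hL.le)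
  rw [integral_volume_emptyWindows t.coe_nonneg hL htL,
    ← map_eq_pi_cond_of_isUniform hXmeas hXunif hXindep,
    map_measureReal_apply (by fun_prop) (measurableSet_le measurable_const
      ((measurable_volume_emptyWindows.sub_const _).abs))] at hconc
  convert hconc using 3
  · ext ω
    rw [mem_preimage, mem_ofPred_eq, mem_ofPred_eq, ← mul_sub, abs_mul,
      abs_of_pos (one_div_pos.2 hL), one_div_mul_eq_div, le_div_iff₀ hL]
  · simp only [Finset.sum_const, Finset.card_univ, Fintype.card_fin, nsmul_eq_mul]
    ring

lemma ae_gap_pos (hL : 0 < L) (hXmeas : ∀ i, Measurable (X i))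
    (hXunif : ∀ i, pdf.IsUniform (X i) (Icc (-L / 2) (L / 2)) P volume)
    (hXindep : iIndepFun X P) : ∀ᵐ ω ∂P, ∀ j, 0 < gap L (fun i => X i ω) j := by
  have hne : ∀ᵐ ω ∂P, ∀ i k, i ≠ k → X i ω ≠ X k ω := by
    refine ae_all_iff.2 fun i => ae_all_iff.2 fun k => ae_all_iff.2 fun hik => ?_
    have : NullSingletonClass (P.map (X k)) := by
      refine ⟨fun y => ?_⟩
      rw [hXunif k]
      exact cond_absolutelyContinuous (measure_singleton y)
    exact ae_ne_of_indepFun (hXmeas i) (hXmeas k) (hXindep.indepFun hik)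
  filter_upwards [ae_all_iff.2 fun i => ae_mem_Ioo_of_isUniform (hXmeas i) (hXunif i), hne]
    with ω hbox hω
  exact gap_pos_of_injective hL (fun i k => not_imp_not.1 (hω i k)) hbox

end

lemma ae_tendsto_emptyWindows [IsProbabilityMeasure P] {lam : ℝ} {L : ℕ → ℝ}
    {X : (N : ℕ) → Fin N → Ω → ℝ} (hL : ∀ N, 0 < L N)
    (hLlam : Tendsto (fun N : ℕ => ((N : ℝ) + 1) / L N) atTop (𝓝 lam))
    (hXmeas : ∀ N i, Measurable (X N i))
    (hXunif : ∀ N i, pdf.IsUniform (X N i) (Icc (-L N / 2) (L N / 2)) P volume)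
    (hXindep : ∀ N, iIndepFun (X N) P) {t : ℝ} (ht : 0 < t) :
    ∀ᵐ ω ∂P, Tendsto (fun N => 1 / L N * volume.real (emptyWindows (L N) t fun i => X N i ω))
      atTop (𝓝 (exp (-(lam * t)))) := by
  have hfluct : ∀ᵐ ω ∂P, Tendsto (fun N => 1 / L N * volume.real
      (emptyWindows (L N) t fun i => X N i ω) - 1 / L N * ((L N - t) * (1 - t / L N) ^ N))
      atTop (𝓝 0) := by
    refine ae_tendsto_zero_of_summable_measureReal fun η hη => ?_
    refine summable_of_isBigO_nat (summable_exp_neg_mul_sq_div hL hLlam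
      (a := η ^ 2 / (2 * t ^ 2)) (by positivity)) (Asymptotics.IsBigO.of_bound 2 ?_)
    filter_upwards [(tendsto_length_atTop hL hLlam).eventually_ge_atTop t] with N hN
    rw [norm_of_nonneg measureReal_nonneg, norm_of_nonneg (exp_pos _).le]
    exact measureReal_abs_emptyWindows_sub_ge_le (hXmeas N) (hXunif N) (hXindep N) ht.le (hL N) hN
      hη.le
  filter_upwards [hfluct] with ω hω
  simpa only [sub_add_cancel, zero_add] using hω.add (tendsto_mean_emptyWindows hL hLlam t)

end Probability

/-! ### Weak convergence of the size-biased law of the lengths -/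

section WeakConvergence

lemma tendsto_map_of_ae_continuousAt {X Y ι : Type*} [MeasurableSpace X] [TopologicalSpace X]
    [OpensMeasurableSpace X] [HasOuterApproxClosed X] [MeasurableSpace Y] [TopologicalSpace Y]
    [OpensMeasurableSpace Y] {F : Filter ι} [F.IsCountablyGenerated]
    {μs : ι → ProbabilityMeasure X} {μ : ProbabilityMeasure X} (h : Tendsto μs F (𝓝 μ))
    {f : X → Y} (hf : Measurable f) (hcont : ∀ᵐ x ∂(μ : Measure X), ContinuousAt f x) :
    Tendsto (fun i => (μs i).map hf.aemeasurable) F (𝓝 (μ.map hf.aemeasurable)) := by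
  refine tendsto_of_forall_isClosed_limsup_le' fun S hS => ?_
  simp only [ProbabilityMeasure.toMeasure_map, Measure.map_apply hf hS.measurableSet]
  have hclosure : (μ : Measure X) (closure (f ⁻¹' S)) ≤ (μ : Measure X) (f ⁻¹' S) := by
    refine measure_mono_ae ?_
    filter_upwards [hcont] with x hx hxS
    exact hS.closure_eq ▸ hx.continuousWithinAt.mem_closure hxS (mapsTo_preimage f S)
  exact (limsup_le_limsup (.of_forall fun i => measure_mono subset_closure)).trans
    ((ProbabilityMeasure.limsup_measure_closed_le_of_tendsto h isClosed_closure).trans hclosure)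

lemma tendsto_integral_of_ae_continuousAt {X ι : Type*} [MeasurableSpace X] [TopologicalSpace X]
    [OpensMeasurableSpace X] [HasOuterApproxClosed X] {F : Filter ι} [F.IsCountablyGenerated]
    {μs : ι → ProbabilityMeasure X} {μ : ProbabilityMeasure X} (h : Tendsto μs F (𝓝 μ))
    {f : X → ℝ} (hf : Measurable f) {C : ℝ} (hC : ∀ x, |f x| ≤ C)
    (hcont : ∀ᵐ x ∂(μ : Measure X), ContinuousAt f x) :
    Tendsto (fun i => ∫ x, f x ∂(μs i : Measure X)) F (𝓝 (∫ x, f x ∂(μ : Measure X))) := by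
  let clip : BoundedContinuousFunction ℝ ℝ := .ofNormedAddCommGroup
    (fun y => max (-|C|) (min y |C|)) (by fun_prop) |C| fun y =>
      abs_le.2 ⟨le_max_left _ _, max_le (neg_le_self (abs_nonneg C)) (min_le_right _ _)⟩
  have hclip (x : X) : clip (f x) = f x := by
    have hx := abs_le.1 ((hC x).trans (le_abs_self C))
    change max (-|C|) (min (f x) |C|) = f x
    rw [min_eq_left hx.2, max_eq_right hx.1]
  have hmap := ProbabilityMeasure.tendsto_iff_forall_integral_tendsto.1
    (tendsto_map_of_ae_continuousAt h hf hcont) clip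
  simpa only [ProbabilityMeasure.toMeasure_map, hclip,
    integral_map hf.aemeasurable clip.continuous.aestronglyMeasurable] using hmap

lemma tendsto_probabilityMeasure_of_tendsto_Ioi {ι : Type*} {F : Filter ι}
    [F.IsCountablyGenerated] {μs : ι → ProbabilityMeasure ℝ} {μ : ProbabilityMeasure ℝ}
    (h : ∀ q : ℚ, Tendsto (fun i => (μs i : Measure ℝ).real (Ioi (q : ℝ))) F
      (𝓝 ((μ : Measure ℝ).real (Ioi (q : ℝ))))) : Tendsto μs F (𝓝 μ) := by
  have hIoc (ν : ProbabilityMeasure ℝ) {a b : ℝ} (hab : a ≤ b) :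
      (ν : Measure ℝ).real (Ioc a b) =
        (ν : Measure ℝ).real (Ioi a) - (ν : Measure ℝ).real (Ioi b) := by
    rw [← Ioc_union_Ioi_eq_Ioi hab,
      measureReal_union (Ioc_disjoint_Ioi le_rfl) measurableSet_Ioi, add_sub_cancel_right]
  refine IsPiSystem.tendsto_probabilityMeasure_of_tendsto_of_mem
    (S := {s | ∃ a b : ℚ, a ≤ b ∧ s = Ioc (a : ℝ) b}) ?_ ?_ ?_ ?_
  · rintro _ ⟨a, b, -, rfl⟩ _ ⟨c, d, -, rfl⟩ hne
    rw [Ioc_inter_Ioc] at hne ⊢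
    exact ⟨max a c, min b d, by exact_mod_cast (nonempty_Ioc.1 hne).le, by push_cast; rfl⟩
  · rintro _ ⟨a, b, -, rfl⟩
    exact measurableSet_Ioc
  · intro u hu x hx
    obtain ⟨a, b, hab, hsub⟩ := mem_nhds_iff_exists_Ioo_subset.1 (hu.mem_nhds hx)
    obtain ⟨p, hap, hpx⟩ := exists_rat_btwn hab.1
    obtain ⟨q, hxq, hqb⟩ := exists_rat_btwn hab.2
    exact ⟨_, ⟨p, q, by exact_mod_cast (hpx.trans hxq).le, rfl⟩, Ioc_mem_nhds hpx hxq,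
      fun z hz => hsub ⟨hap.trans hz.1, hz.2.trans_lt hqb⟩⟩
  · rintro _ ⟨a, b, hab, rfl⟩
    have hab' : (a : ℝ) ≤ b := by exact_mod_cast hab
    rw [← NNReal.tendsto_coe]
    change Tendsto (fun i => (μs i : Measure ℝ).real (Ioc (a : ℝ) b)) F
      (𝓝 ((μ : Measure ℝ).real (Ioc (a : ℝ) b)))
    simp only [hIoc _ hab']
    exact (h a).sub (h b)

end WeakConvergence

section SizeBiased

variable {ι : Type*} [Fintype ι] {L : ℝ} {g : ι → ℝ}

/-- The size-biased empirical measure of the numbers `g j`, whose sum is meant to be `L`. -/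
def sizeBiased (L : ℝ) (g : ι → ℝ) : Measure ℝ :=
  ∑ j, ENNReal.ofReal (g j / L) • Measure.dirac (g j)

lemma integral_sizeBiased (hL : 0 ≤ L) (hg : ∀ j, 0 ≤ g j) (f : ℝ → ℝ) :
    ∫ x, f x ∂sizeBiased L g = 1 / L * ∑ j, g j * f (g j) := by
  rw [sizeBiased, integral_finsetSum_measure fun j _ =>
    (integrable_dirac (by simp)).smul_measure ENNReal.ofReal_ne_top, Finset.mul_sum]
  refine Finset.sum_congr rfl fun j _ => ?_
  rw [integral_smul_measure, integral_dirac, ENNReal.toReal_ofReal (div_nonneg (hg j) hL),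
    smul_eq_mul]
  ring

lemma isProbabilityMeasure_sizeBiased (hL : 0 < L) (hg : ∀ j, 0 ≤ g j) (hsum : ∑ j, g j = L) :
    IsProbabilityMeasure (sizeBiased L g) := by
  refine ⟨?_⟩
  simp only [sizeBiased, Measure.finsetSum_apply, Measure.smul_apply, measure_univ, smul_eq_mul,
    mul_one]
  rw [← ENNReal.ofReal_sum_of_nonneg fun j _ => div_nonneg (hg j) hL.le, ← Finset.sum_div, hsum,
    div_self hL.ne', ENNReal.ofReal_one]

lemma sizeBiased_real (hL : 0 ≤ L) (hg : ∀ j, 0 ≤ g j) {s : Set ℝ} (hs : MeasurableSet s) :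
    (sizeBiased L g).real s = 1 / L * ∑ j, g j * s.indicator 1 (g j) := by
  rw [← integral_indicator_one hs, integral_sizeBiased hL hg]

end SizeBiased

section Gamma

lemma ae_gammaMeasure_of_ae_restrict {a r : ℝ} {p : ℝ → Prop}
    (h : ∀ᵐ x ∂volume.restrict (Ioi 0), p x) : ∀ᵐ x ∂gammaMeasure a r, p x := by
  rw [restrict_Ioi_eq_restrict_Ici, ae_restrict_iff' measurableSet_Ici] at h
  have hmeas : Measurable (gammaPDF a r) := (measurable_gammaPDFReal a r).ennreal_ofReal
  rw [gammaMeasure, ae_withDensity_iff hmeas]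
  filter_upwards [h] with x hx hne
  exact hx (not_lt.1 fun hlt => hne (gammaPDF_of_neg hlt))

lemma integral_gammaMeasure_two (lam : ℝ) (f : ℝ → ℝ) :
    ∫ x, f x ∂gammaMeasure 2 lam = lam ^ 2 * ∫ ℓ in Ioi (0 : ℝ), exp (-lam * ℓ) * (ℓ * f ℓ) := by
  have hpdf (x : ℝ) : (gammaPDF 2 lam x).toReal • f x =
      (Ioi (0 : ℝ)).indicator (fun ℓ => lam ^ 2 * (exp (-lam * ℓ) * (ℓ * f ℓ))) x := by
    rcases lt_trichotomy x 0 with hx | rfl | hx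
    · rw [gammaPDF_of_neg hx, indicator_of_notMem (notMem_Ioi.2 hx.le), ENNReal.toReal_zero,
        zero_smul]
    · rw [gammaPDF_of_nonneg le_rfl, indicator_of_notMem self_notMem_Ioi, zero_rpow (by norm_num),
        mul_zero, zero_mul, ENNReal.ofReal_zero, ENNReal.toReal_zero, zero_smul]
    · rw [gammaPDF_of_nonneg hx.le, indicator_of_mem (mem_Ioi.2 hx), Real.Gamma_two, rpow_two,
        ENNReal.toReal_ofReal (by positivity), show (2 : ℝ) - 1 = 1 by norm_num, rpow_one,
        smul_eq_mul]
      ring_nf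
  have hmeas : Measurable (gammaPDF 2 lam) := (measurable_gammaPDFReal 2 lam).ennreal_ofReal
  rw [gammaMeasure, integral_withDensity_eq_integral_toReal_smul hmeas (by simp [gammaPDF])]
  simp only [hpdf]
  rw [integral_indicator measurableSet_Ioi, integral_const_mul]

lemma hasDerivAt_neg_one_add_mul_exp (lam x : ℝ) :
    HasDerivAt (fun x => -((1 + lam * x) * exp (-lam * x))) (lam ^ 2 * (exp (-lam * x) * x)) x := by
  have hlin : HasDerivAt (fun x => 1 + lam * x) lam x := by
    simpa using ((hasDerivAt_id x).const_mul lam).const_add 1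
  have hexp : HasDerivAt (fun x => exp (-lam * x)) (exp (-lam * x) * -lam) x := by
    simpa using ((hasDerivAt_id x).const_mul (-lam)).exp
  exact (hlin.mul hexp).neg.congr_deriv (by ring)

lemma tendsto_one_add_mul_exp_neg {lam : ℝ} (hlam : 0 < lam) :
    Tendsto (fun x => (1 + lam * x) * exp (-lam * x)) atTop (𝓝 0) := by
  have hlin : Tendsto (fun x => lam * x) atTop atTop := tendsto_id.const_mul_atTop hlam
  have h := ((tendsto_pow_mul_exp_neg_atTop_nhds_zero 0).comp hlin).add
    ((tendsto_pow_mul_exp_neg_atTop_nhds_zero 1).comp hlin)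
  rw [add_zero] at h
  refine h.congr fun x => ?_
  simp only [Function.comp, neg_mul]
  ring

lemma gammaMeasure_two_real_Ioi {lam : ℝ} (hlam : 0 < lam) {t : ℝ} (ht : 0 ≤ t) :
    (gammaMeasure 2 lam).real (Ioi t) = (1 + lam * t) * exp (-lam * t) := by
  have hnonneg (x : ℝ) (hx : x ∈ Ioi t) : 0 ≤ lam ^ 2 * (exp (-lam * x) * x) := by
    have := ht.trans_lt hx
    positivity
  have hind : EqOn (fun x => exp (-lam * x) * (x * (Ioi t).indicator 1 x))
      ((Ioi t).indicator fun x => exp (-lam * x) * x) (Ioi 0) := fun x _ => by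
    by_cases hx : x ∈ Ioi t <;> simp [hx]
  rw [← integral_indicator_one measurableSet_Ioi, integral_gammaMeasure_two,
    setIntegral_congr_fun measurableSet_Ioi hind, setIntegral_indicator measurableSet_Ioi,
    inter_eq_right.2 (Ioi_subset_Ioi ht), ← integral_const_mul,
    integral_Ioi_of_hasDerivAt_of_nonneg' (fun x _ => hasDerivAt_neg_one_add_mul_exp lam x)
      hnonneg (by simpa using (tendsto_one_add_mul_exp_neg hlam).neg)]
  ring

end Gamma

/-! ### The law of large numbers for the lengths -/

lemma tendsto_subgradient {ι : Type*} {F : Filter ι} {φ : ι → ℝ → ℝ} {Φ : ℝ → ℝ} {d : ι → ℝ}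
    {Φ' t : ℝ} {S : Set ℝ} (hS : Dense S) (hd : ∀ i s, φ i t + d i * (s - t) ≤ φ i s)
    (ht : Tendsto (φ · t) F (𝓝 (Φ t)))
    (hφ : ∀ᶠ s in 𝓝 t, s ∈ S → Tendsto (φ · s) F (𝓝 (Φ s))) (hΦ : HasDerivAt Φ Φ' t) :
    Tendsto d F (𝓝 Φ') := by
  have hslope {s : ℝ} (hs : Tendsto (φ · s) F (𝓝 (Φ s))) :
      Tendsto (fun i => slope (φ i) t s) F (𝓝 (slope Φ t s)) := by
    simpa only [slope_def_field] using (hs.sub ht).div_const (s - t)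
  refine tendsto_order.2 ⟨fun y hy => ?_, fun y hy => ?_⟩
  · have hev := ((hasDerivAt_iff_tendsto_slope.1 hΦ).mono_left
      (nhdsLT_le_nhdsNE t)).eventually_const_lt hy
    obtain ⟨l, hl, hsub⟩ := mem_nhdsLT_iff_exists_Ioo_subset.1
      (hev.and (hφ.filter_mono nhdsWithin_le_nhds))
    obtain ⟨s, hsS, hs⟩ := hS.exists_between hl
    filter_upwards [(hslope ((hsub hs).2 hsS)).eventually_const_lt (hsub hs).1] with i hi
    refine hi.trans_le ?_
    rw [slope_def_field, div_le_iff_of_neg (sub_neg.2 hs.2)]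
    linarith [hd i s]
  · have hev := ((hasDerivAt_iff_tendsto_slope.1 hΦ).mono_left
      (nhdsGT_le_nhdsNE t)).eventually_lt_const hy
    obtain ⟨u, hu, hsub⟩ := mem_nhdsGT_iff_exists_Ioo_subset.1
      (hev.and (hφ.filter_mono nhdsWithin_le_nhds))
    obtain ⟨s, hsS, hs⟩ := hS.exists_between hu
    filter_upwards [(hslope ((hsub hs).2 hsS)).eventually_lt_const (hsub hs).1] with i hi
    refine lt_of_le_of_lt ?_ hi
    rw [slope_def_field, le_div_iff₀ (sub_pos.2 hs.1)]
    linarith [hd i s]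

section LawOfLargeNumbers

variable {ι : Type*} {F : Filter ι} {κ : ι → Type*} [∀ i, Fintype (κ i)] {lam : ℝ} {L : ι → ℝ}
  {g : (i : ι) → κ i → ℝ}

lemma mul_indicator_Ioi_eq (t x : ℝ) :
    x * (Ioi t).indicator 1 x = max (x - t) 0 + t * (Ioi t).indicator 1 x := by
  by_cases hx : t < x
  · rw [indicator_of_mem (mem_Ioi.2 hx), max_eq_left (by linarith), Pi.one_apply]
    ring
  · rw [indicator_of_notMem (notMem_Ioi.2 (not_lt.1 hx)), max_eq_right (by linarith)]
    ring

lemma max_sub_zero_sub_indicator_le (t s x : ℝ) :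
    max (x - t) 0 - (Ioi t).indicator 1 x * (s - t) ≤ max (x - s) 0 := by
  by_cases hx : t < x
  · rw [indicator_of_mem (mem_Ioi.2 hx), max_eq_left (by linarith), Pi.one_apply]
    exact (by ring : x - t - 1 * (s - t) = x - s).trans_le (le_max_left _ _)
  · rw [indicator_of_notMem (notMem_Ioi.2 (not_lt.1 hx)), max_eq_right (by linarith), zero_mul,
      sub_zero]
    exact le_max_right _ _

/- The excess `L⁻¹ ∑ⱼ max (gⱼ - t) 0` is convex in `t`, with minus the number density of the `gⱼ`
beyond `t` as a subgradient, so the latter converges to the derivative of the limit. -/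
lemma tendsto_sum_mul_indicator_Ioi (hL : ∀ i, 0 < L i)
    (hexcess : ∀ q : ℚ, 0 < q → Tendsto (fun i => 1 / L i * ∑ j, max (g i j - q) 0) F
      (𝓝 (exp (-(lam * q))))) {t : ℚ} (ht : 0 < t) :
    Tendsto (fun i => 1 / L i * ∑ j, g i j * (Ioi (t : ℝ)).indicator 1 (g i j)) F
      (𝓝 ((1 + lam * t) * exp (-lam * t))) := by
  have hderiv : HasDerivAt (fun t : ℝ => exp (-(lam * t))) (-(lam * exp (-(lam * t)))) t :=
    ((hasDerivAt_id (t : ℝ)).const_mul lam).neg.exp.congr_deriv (by simp; ring)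
  have hcount := tendsto_subgradient (S := range ((↑) : ℚ → ℝ)) Rat.denseRange_cast
    (φ := fun i t => 1 / L i * ∑ j, max (g i j - t) 0)
    (d := fun i => -(1 / L i * ∑ j, (Ioi (t : ℝ)).indicator 1 (g i j))) ?_ (hexcess t ht) ?_ hderiv
  · have h := (hexcess t ht).add (hcount.const_mul (-t : ℝ))
    convert h using 2 with i
    · simp only [mul_indicator_Ioi_eq, Finset.sum_add_distrib, ← Finset.mul_sum]
      ring
    · rw [neg_mul]
      ring
  · intro i s
    calc 1 / L i * ∑ j, max (g i j - t) 0 +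
          -(1 / L i * ∑ j, (Ioi (t : ℝ)).indicator 1 (g i j)) * (s - t)
        = 1 / L i * ∑ j, (max (g i j - t) 0 - (Ioi (t : ℝ)).indicator 1 (g i j) * (s - t)) := by
          rw [Finset.sum_sub_distrib, ← Finset.sum_mul]
          ring
      _ ≤ 1 / L i * ∑ j, max (g i j - s) 0 := by
          have := hL i
          gcongr with j
          exact max_sub_zero_sub_indicator_le _ _ _
  · filter_upwards [lt_mem_nhds (show (0 : ℝ) < t by exact_mod_cast ht)]
    rintro _ hq ⟨q, rfl⟩
    exact hexcess q (by exact_mod_cast hq)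

lemma tendsto_sizeBiased [F.IsCountablyGenerated] (hlam : 0 < lam) (hL : ∀ i, 0 < L i)
    (hg : ∀ i j, 0 < g i j) (hsum : ∀ i, ∑ j, g i j = L i)
    (hexcess : ∀ q : ℚ, 0 < q → Tendsto (fun i => 1 / L i * ∑ j, max (g i j - q) 0) F
      (𝓝 (exp (-(lam * q))))) :
    Tendsto (β := ProbabilityMeasure ℝ) (fun i => ⟨sizeBiased (L i) (g i),
        isProbabilityMeasure_sizeBiased (hL i) (fun j => (hg i j).le) (hsum i)⟩) F
      (𝓝 ⟨gammaMeasure 2 lam, isProbabilityMeasure_gammaMeasure two_pos hlam⟩) := by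
  have := isProbabilityMeasure_gammaMeasure two_pos hlam
  refine tendsto_probabilityMeasure_of_tendsto_Ioi fun q => ?_
  simp only [ProbabilityMeasure.coe_mk, sizeBiased_real (hL _).le (fun j => (hg _ j).le)
    measurableSet_Ioi]
  rcases lt_or_ge 0 q with hq | hq
  · rw [gammaMeasure_two_real_Ioi hlam (by exact_mod_cast hq.le)]
    exact tendsto_sum_mul_indicator_Ioi hL hexcess hq
  · have hq' : (q : ℝ) ≤ 0 := by exact_mod_cast hq
    have hlim : (gammaMeasure 2 lam).real (Ioi (q : ℝ)) = 1 := by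
      have hmem : ∀ᵐ x ∂gammaMeasure 2 lam, x ∈ Ioi (q : ℝ) := ae_gammaMeasure_of_ae_restrict
        ((ae_restrict_mem measurableSet_Ioi).mono fun x hx => hq'.trans_lt hx)
      rw [measureReal_def, mem_ae_iff_prob_eq_one measurableSet_Ioi |>.1 hmem, ENNReal.toReal_one]
    rw [hlim]
    refine tendsto_const_nhds.congr fun i => ?_
    simp only [indicator_of_mem (mem_Ioi.2 (hq'.trans_lt (hg _ _))), Pi.one_apply, mul_one, hsum,
      one_div_mul_cancel (hL _).ne']

lemma tendsto_sum_of_tendsto_excess [F.IsCountablyGenerated] (hlam : 0 < lam) (hL : ∀ i, 0 < L i)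
    (hg : ∀ i j, 0 < g i j) (hsum : ∀ i, ∑ j, g i j = L i)
    (hexcess : ∀ q : ℚ, 0 < q → Tendsto (fun i => 1 / L i * ∑ j, max (g i j - q) 0) F
      (𝓝 (exp (-(lam * q)))))
    {f : ℝ → ℝ} (hf : Measurable f) {C : ℝ} (hC : ∀ ℓ, 0 < ℓ → |f ℓ| ≤ C * ℓ)
    (hcont : ∀ᵐ ℓ ∂volume.restrict (Ioi (0 : ℝ)), ContinuousAt f ℓ) :
    Tendsto (fun i => 1 / L i * ∑ j, f (g i j)) F
      (𝓝 (lam ^ 2 * ∫ ℓ in Ioi (0 : ℝ), exp (-lam * ℓ) * f ℓ)) := by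
  let f₁ : ℝ → ℝ := (Ioi (0 : ℝ)).indicator fun ℓ => f ℓ / ℓ
  have hmul {ℓ : ℝ} (hℓ : 0 < ℓ) : ℓ * f₁ ℓ = f ℓ := by
    simp only [f₁, indicator_of_mem (mem_Ioi.2 hℓ), mul_div_cancel₀ _ hℓ.ne']
  have hbound (x : ℝ) : |f₁ x| ≤ |C| := by
    by_cases hx : 0 < x
    · rw [← mul_le_mul_iff_right₀ hx, ← abs_of_pos hx, ← abs_mul, abs_of_pos hx, hmul hx]
      exact (hC x hx).trans (by nlinarith [le_abs_self C])
    · simp only [f₁, indicator_of_notMem (show x ∉ Ioi 0 from hx), abs_zero, abs_nonneg]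
  have hcont₁ : ∀ᵐ x ∂gammaMeasure 2 lam, ContinuousAt f₁ x := by
    refine ae_gammaMeasure_of_ae_restrict ?_
    filter_upwards [hcont, ae_restrict_mem measurableSet_Ioi] with x hx hx0
    refine (hx.div continuousAt_id (ne_of_gt hx0)).congr ?_
    filter_upwards [Ioi_mem_nhds hx0] with y hy
    exact (indicator_of_mem hy _).symm
  have hmeas₁ : Measurable f₁ := (hf.div measurable_id).indicator measurableSet_Ioi
  have h := tendsto_integral_of_ae_continuousAt (tendsto_sizeBiased hlam hL hg hsum hexcess)
    hmeas₁ hbound hcont₁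
  simp only [ProbabilityMeasure.coe_mk, integral_gammaMeasure_two,
    integral_sizeBiased (hL _).le fun j => (hg _ j).le] at h
  rw [setIntegral_congr_fun measurableSet_Ioi fun ℓ hℓ => congrArg (exp (-lam * ℓ) * ·) (hmul hℓ)]
    at h
  exact h.congr fun i => by rw [Finset.sum_congr rfl fun j _ => hmul (hg i j)]

end LawOfLargeNumbers

/-! ### The limiting density of states -/

/-- The length of an interval whose `s + 1`-st Dirichlet eigenvalue is `E > 0`, i.e. the inverse of
`fun ℓ => energy ℓ (s + 1)` on the positive half-line. -/
def lengthOfEnergy (s : ℕ) (E : ℝ) : ℝ := π / √2 * (s + 1) / √E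

section Dos

variable {lam β μ E ℓ : ℝ}

lemma lengthOfEnergy_pos (s : ℕ) (hE : 0 < E) : 0 < lengthOfEnergy s E := by
  unfold lengthOfEnergy; positivity

lemma energy_lengthOfEnergy (s : ℕ) (hE : 0 < E) : energy (lengthOfEnergy s E) (s + 1) = E := by
  rw [energy, lengthOfEnergy, div_pow, mul_pow, div_pow, sq_sqrt hE.le, sq_sqrt zero_le_two]
  push_cast
  field_simp

lemma lengthOfEnergy_energy (s : ℕ) (hℓ : 0 < ℓ) : lengthOfEnergy s (energy ℓ (s + 1)) = ℓ :=
  (strictAntiOn_energy s).injOn (lengthOfEnergy_pos s (energy_pos hℓ s)) hℓ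
    (energy_lengthOfEnergy s (energy_pos hℓ s))

lemma injOn_lengthOfEnergy (s : ℕ) : InjOn (lengthOfEnergy s) (Ioi 0) :=
  LeftInvOn.injOn (f₁' := fun ℓ => energy ℓ (s + 1)) fun _ => energy_lengthOfEnergy s

lemma image_lengthOfEnergy (s : ℕ) : lengthOfEnergy s '' Ioi 0 = Ioi 0 :=
  (image_subset_iff.2 fun _ => lengthOfEnergy_pos s).antisymm fun ℓ hℓ =>
    ⟨energy ℓ (s + 1), energy_pos hℓ s, lengthOfEnergy_energy s hℓ⟩

lemma rpow_three_halves (hE : 0 ≤ E) : E ^ (3 / 2 : ℝ) = √E ^ 3 := by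
  rw [rpow_div_two_eq_sqrt 3 hE]
  norm_cast

lemma hasDerivAt_lengthOfEnergy (s : ℕ) (hE : 0 < E) :
    HasDerivAt (lengthOfEnergy s) (-(π / √2 * (s + 1) / (2 * E ^ (3 / 2 : ℝ)))) E := by
  refine (((hasDerivAt_sqrt hE.ne').inv (sqrt_pos.2 hE).ne').const_mul
    (π / √2 * (s + 1))).congr_deriv ?_
  rw [rpow_three_halves hE.le]
  field_simp

lemma hasSum_add_one_mul_pow_succ {r : ℝ} (hr : ‖r‖ < 1) :
    HasSum (fun s : ℕ => ((s : ℝ) + 1) * r ^ (s + 1)) (r / (1 - r) ^ 2) := by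
  simpa using (hasSum_nat_add_iff' (f := fun n : ℕ => (n : ℝ) * r ^ n) 1).2
    (hasSum_coe_mul_geometric_of_norm_lt_one hr)

lemma hasSum_dos (hlam : 0 < lam) (hE : 0 < E) :
    HasSum (fun s : ℕ => π / √2 * (s + 1) / (2 * E ^ (3 / 2 : ℝ)) *
      (lam ^ 2 * exp (-lam * lengthOfEnergy s E))) (dos lam E) := by
  set r := exp (-(π / √2 * lam / √E)) with hr
  have hr1 : r < 1 := exp_lt_one_iff.2 (neg_lt_zero.2 (by positivity))
  have hr0 : 0 < r := exp_pos _
  have hpow (s : ℕ) : exp (-lam * lengthOfEnergy s E) = r ^ (s + 1) := by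
    rw [hr, ← exp_nat_mul, lengthOfEnergy]
    push_cast
    ring_nf
  have hdos : dos lam E =
      lam ^ 2 * (π / √2) / (2 * E ^ (3 / 2 : ℝ)) * (r / (1 - r) ^ 2) := by
    have hinv : exp (π / √2 * lam / √E) = r⁻¹ := by rw [hr, exp_neg, inv_inv]
    have hsub : r⁻¹ - 1 = (1 - r) / r := by rw [sub_div, div_self hr0.ne', one_div]
    have : 1 - r ≠ 0 := (sub_pos.2 hr1).ne'
    rw [dos, hinv, hsub]
    field_simp
  rw [hdos]
  refine ((hasSum_add_one_mul_pow_succ (by rwa [norm_of_nonneg hr0.le])).mul_left _).congr_fun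
    fun s => ?_
  rw [hpow]
  ring

lemma lintegral_Ioi_eq_lintegral_comp_lengthOfEnergy (s : ℕ) (h : ℝ → ENNReal) :
    ∫⁻ ℓ in Ioi 0, h ℓ = ∫⁻ E in Ioi 0,
      ENNReal.ofReal (π / √2 * (s + 1) / (2 * E ^ (3 / 2 : ℝ))) * h (lengthOfEnergy s E) := by
  conv_lhs => rw [← image_lengthOfEnergy s]
  rw [lintegral_image_eq_lintegral_abs_deriv_mul measurableSet_Ioi
    (fun E hE => (hasDerivAt_lengthOfEnergy s hE).hasDerivWithinAt) (injOn_lengthOfEnergy s)]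
  refine setLIntegral_congr_fun measurableSet_Ioi fun E hE => ?_
  rw [mem_Ioi] at hE
  rw [abs_neg, abs_of_pos (by positivity)]

lemma lintegral_dos_mul (hlam : 0 < lam) {f : ℝ → ENNReal} (hf : Measurable f) :
    ∫⁻ E in Ioi 0, ENNReal.ofReal (dos lam E) * f E =
      ∫⁻ ℓ in Ioi 0, ENNReal.ofReal (lam ^ 2 * exp (-lam * ℓ)) *
        ∑' s : ℕ, f (energy ℓ (s + 1)) := by
  let jac (s : ℕ) (E : ℝ) : ENNReal := ENNReal.ofReal (π / √2 * (s + 1) / (2 * E ^ (3 / 2 : ℝ)))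
  let w (ℓ : ℝ) : ENNReal := ENNReal.ofReal (lam ^ 2 * exp (-lam * ℓ))
  have hjac (s : ℕ) : Measurable (jac s) := by fun_prop
  have hw : Measurable w := by fun_prop
  have hlength (s : ℕ) : Measurable (lengthOfEnergy s) := by unfold lengthOfEnergy; fun_prop
  have hdos {E : ℝ} (hE : E ∈ Ioi 0) :
      ENNReal.ofReal (dos lam E) = ∑' s, jac s E * w (lengthOfEnergy s E) := by
    rw [mem_Ioi] at hE
    have hsum := hasSum_dos hlam hE
    rw [← hsum.tsum_eq, ENNReal.ofReal_tsum_of_nonneg (fun s => by positivity) hsum.summable]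
    exact tsum_congr fun s => ENNReal.ofReal_mul (by positivity)
  calc ∫⁻ E in Ioi 0, ENNReal.ofReal (dos lam E) * f E
      = ∫⁻ E in Ioi 0, ∑' s, jac s E * w (lengthOfEnergy s E) * f E :=
        setLIntegral_congr_fun measurableSet_Ioi fun E hE => by
          simp only [hdos hE, ENNReal.tsum_mul_right]
    _ = ∑' s, ∫⁻ E in Ioi 0, jac s E * w (lengthOfEnergy s E) * f E :=
        lintegral_tsum fun s => (((hjac s).mul (hw.comp (hlength s))).mul hf).aemeasurable
    _ = ∑' s : ℕ, ∫⁻ ℓ in Ioi 0, w ℓ * f (energy ℓ (s + 1)) := tsum_congr fun s => by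
        rw [lintegral_Ioi_eq_lintegral_comp_lengthOfEnergy s fun ℓ => w ℓ * f (energy ℓ (s + 1))]
        refine setLIntegral_congr_fun measurableSet_Ioi fun E hE => ?_
        simp only [energy_lengthOfEnergy s hE, mul_assoc, jac]
    _ = ∫⁻ ℓ in Ioi 0, ∑' s : ℕ, w ℓ * f (energy ℓ (s + 1)) :=
        (lintegral_tsum fun s => (hw.mul (hf.comp (measurable_energy (s + 1)))).aemeasurable).symm
    _ = ∫⁻ ℓ in Ioi 0, w ℓ * ∑' s : ℕ, f (energy ℓ (s + 1)) := by simp only [ENNReal.tsum_mul_left]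

lemma dos_nonneg (hE : 0 ≤ E) : 0 ≤ dos lam E := by
  unfold dos; positivity

lemma integral_dos_mul (hlam : 0 < lam) {f : ℝ → ℝ} (hf : Measurable f)
    (hnonneg : ∀ E, 0 < E → 0 ≤ f E)
    (hsum : ∀ ℓ, 0 < ℓ → Summable fun s : ℕ => f (energy ℓ (s + 1))) :
    ∫ E in Ioi 0, dos lam E * f E =
      lam ^ 2 * ∫ ℓ in Ioi (0 : ℝ), exp (-lam * ℓ) * ∑' s : ℕ, f (energy ℓ (s + 1)) := by
  have hfE (s : ℕ) : Measurable fun ℓ => f (energy ℓ (s + 1)) := hf.comp (measurable_energy _)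
  have hdos : Measurable (dos lam) := by unfold dos; fun_prop
  rw [← integral_const_mul, integral_eq_lintegral_of_nonneg_ae, integral_eq_lintegral_of_nonneg_ae]
  · congr 1
    calc ∫⁻ E in Ioi 0, ENNReal.ofReal (dos lam E * f E)
        = ∫⁻ E in Ioi 0, ENNReal.ofReal (dos lam E) * ENNReal.ofReal (f E) :=
          setLIntegral_congr_fun measurableSet_Ioi fun E hE =>
            ENNReal.ofReal_mul (dos_nonneg (le_of_lt hE))
      _ = ∫⁻ ℓ in Ioi 0, ENNReal.ofReal (lam ^ 2 * exp (-lam * ℓ)) *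
            ∑' s : ℕ, ENNReal.ofReal (f (energy ℓ (s + 1))) :=
          lintegral_dos_mul hlam hf.ennreal_ofReal
      _ = ∫⁻ ℓ in Ioi 0, ENNReal.ofReal
            (lam ^ 2 * (exp (-lam * ℓ) * ∑' s : ℕ, f (energy ℓ (s + 1)))) :=
          setLIntegral_congr_fun measurableSet_Ioi fun ℓ hℓ => by
            rw [← mul_assoc (lam ^ 2), ENNReal.ofReal_mul (p := lam ^ 2 * _) (by positivity),
              ENNReal.ofReal_tsum_of_nonneg (fun s => hnonneg _ (energy_pos hℓ s)) (hsum ℓ hℓ)]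
  · filter_upwards [ae_restrict_mem measurableSet_Ioi] with ℓ hℓ
    have : 0 ≤ ∑' s : ℕ, f (energy ℓ (s + 1)) := tsum_nonneg fun s => hnonneg _ (energy_pos hℓ s)
    positivity
  · exact (Measurable.const_mul (Measurable.mul (by fun_prop) (Measurable.tsum hfE))
      _).aestronglyMeasurable
  · filter_upwards [ae_restrict_mem measurableSet_Ioi] with E hE
    exact mul_nonneg (dos_nonneg (le_of_lt hE)) (hnonneg E hE)
  · exact (hdos.mul hf).aestronglyMeasurable

end Dos

section CriticalDensity

variable {lam β ε μ ν ℓ : ℝ}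

lemma cutoffSum_zero_one (β μ : ℝ) (hℓ : 0 < ℓ) :
    cutoffSum β 0 μ 1 ℓ = ∑' s : ℕ, occ β μ (energy ℓ (s + 1)) :=
  tsum_congr fun s => by rw [cutoffOcc_of_lt (energy_pos hℓ s), Pi.one_apply, Pi.one_apply, mul_one]

lemma limDensity_eq_limCutoffDensity (hlam : 0 < lam) (hβ : 0 < β) (hμ : μ ≤ 0) :
    limDensity lam β μ = limCutoffDensity lam β 0 μ 1 := by
  unfold limDensity limCutoffDensity
  rw [integral_dos_mul hlam (measurable_occ β μ) (fun E hE => (occ_pos hβ (hμ.trans_lt hE)).le)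
    fun ℓ hℓ => summable_occ hβ hℓ (hμ.trans_lt (energy_pos hℓ 0))]
  congr 1
  exact setIntegral_congr_fun measurableSet_Ioi fun ℓ hℓ => by
    simp only [cutoffSum_zero_one β μ hℓ]

lemma tendsto_limDensity (hlam : 0 < lam) (hβ : 0 < β) :
    Tendsto (limDensity lam β) (𝓝[<] 0) (𝓝 (limCutoffDensity lam β 0 0 1)) := by
  have hnonpos : ∀ᶠ μ in 𝓝[<] (0 : ℝ), μ ≤ 0 := eventually_mem_nhdsWithin.mono fun _ h => le_of_lt h
  refine (tendsto_limCutoffDensity hlam hβ (e := fun _ => 0) (w := fun _ => 1)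
    (.of_forall fun _ => le_rfl) hnonpos (fun _ _ => measurable_const)
    (.of_forall fun _ _ _ _ => abs_one.le) ?_).congr' ?_
  · intro ℓ hℓ s
    exact ((continuousAt_cutoffOcc_left hβ (energy_pos hℓ s)).tendsto.mono_left
      nhdsWithin_le_nhds).mul_const _
  · filter_upwards [hnonpos] with μ hμ
    exact (limDensity_eq_limCutoffDensity hlam hβ hμ).symm

lemma critDensity_eq (hlam : 0 < lam) (hβ : 0 < β) :
    critDensity lam β = limCutoffDensity lam β 0 0 1 :=
  (tendsto_limDensity hlam hβ).limUnder_eq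

lemma tendsto_limCutoffDensity_zero {a : ℝ → ℕ → ℝ} (hlam : 0 < lam) (hβ : 0 < β)
    (ham : ∀ s, Measurable (fun ℓ => a ℓ s)) (ha : ∀ ℓ, 0 < ℓ → ∀ s, |a ℓ s| ≤ 1) :
    Tendsto (fun ε => limCutoffDensity lam β ε 0 a) (𝓝[>] 0)
      (𝓝 (limCutoffDensity lam β 0 0 a)) := by
  refine tendsto_limCutoffDensity hlam hβ (m := fun _ => 0) (w := fun _ => a)
    (eventually_mem_nhdsWithin.mono fun _ h => le_of_lt h) (.of_forall fun _ => le_rfl)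
    (fun _ => ham) (.of_forall fun _ => ha) fun ℓ hℓ s => tendsto_const_nhds.congr' ?_
  have hE := energy_pos hℓ s
  filter_upwards [nhdsWithin_le_nhds (Iio_mem_nhds hE)] with ε hε
  rw [cutoffOcc_of_lt hE, cutoffOcc_of_lt hε]

lemma tendsto_limCutoffDensity_overlap (hlam : 0 < lam) (hβ : 0 < β) :
    Tendsto (fun d => limCutoffDensity lam β 0 0 (overlap d)) atTop (𝓝 0) := by
  suffices Tendsto (fun d => limCutoffDensity lam β 0 0 (overlap d)) atTop
      (𝓝 (limCutoffDensity lam β 0 0 0)) by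
    simpa [limCutoffDensity, cutoffSum] using this
  refine tendsto_limCutoffDensity hlam hβ (e := fun _ => 0) (m := fun _ => 0)
    (.of_forall fun _ => le_rfl) (.of_forall fun _ => le_rfl) measurable_overlap ?_ ?_
  · filter_upwards [eventually_ge_atTop 0] with d hd ℓ hℓ using abs_overlap_le_one hd hℓ
  · intro ℓ _ s
    refine tendsto_const_nhds.congr' ?_
    filter_upwards [eventually_gt_atTop ℓ] with d hd
    rw [overlap, if_neg (not_le.2 hd), Pi.zero_apply, Pi.zero_apply]

lemma limCutoffDensity_mono (hlam : 0 < lam) (hβ : 0 < β) (h : μ ≤ ν) (hν : ν ≤ 0) :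
    limCutoffDensity lam β 0 μ 1 ≤ limCutoffDensity lam β 0 ν 1 := by
  have hint {κ : ℝ} (hκ : κ ≤ 0) :=
    integrableOn_exp_neg_mul_mul_cutoffSum hlam hβ le_rfl hκ (a := 1) (fun _ => measurable_const)
      fun _ _ _ => abs_one.le
  have hsum {ℓ κ : ℝ} (hℓ : 0 < ℓ) (hκ : κ ≤ 0) :
      Summable fun s : ℕ => occ β κ (energy ℓ (s + 1)) :=
    summable_occ hβ hℓ (hκ.trans_lt (energy_pos hℓ 0))
  refine mul_le_mul_of_nonneg_left ?_ (sq_nonneg _)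
  refine setIntegral_mono_on (hint (h.trans hν)) (hint hν) measurableSet_Ioi fun ℓ hℓ => ?_
  rw [cutoffSum_zero_one β μ hℓ, cutoffSum_zero_one β ν hℓ]
  gcongr with s
  · exact hsum hℓ (h.trans hν)
  · exact hsum hℓ hν
  · have hE := energy_pos hℓ s
    exact (strictMonoOn_occ hβ _).monotoneOn (h.trans_lt (hν.trans_lt hE)) (hν.trans_lt hE) h

lemma limCutoffDensity_nonneg (lam : ℝ) (hβ : 0 < β) (h : μ ≤ ε) :
    0 ≤ limCutoffDensity lam β ε μ 1 :=
  mul_nonneg (sq_nonneg _) <| integral_nonneg fun _ => mul_nonneg (exp_pos _).le <|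
    tsum_nonneg fun _ => mul_nonneg (cutoffOcc_nonneg hβ h _) zero_le_one

end CriticalDensity

/-! ### The finite system -/

/-- The lowest one-particle energy of the finite system. -/
def groundEnergy {N : ℕ} (L : ℝ) (x : Fin N → ℝ) : ℝ :=
  Finset.univ.inf' Finset.univ_nonempty fun j => energy (gap L x j) 1

section FiniteVolume

variable {N : ℕ} {L β ε μ ρ ℓ : ℝ} {x : Fin N → ℝ}

lemma lt_groundEnergy_iff : μ < groundEnergy L x ↔ ∀ j, μ < energy (gap L x j) 1 := by
  simp only [groundEnergy, Finset.lt_inf'_iff, Finset.mem_univ, true_imp_iff]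

lemma lt_energy_of_lt_groundEnergy (h : μ < groundEnergy L x) (j : Fin (N + 1)) (s : ℕ) :
    μ < energy (gap L x j) (s + 1) :=
  (lt_groundEnergy_iff.1 h j).trans_le (energy_one_le _ s)

lemma groundEnergy_pos (hg : ∀ j, 0 < gap L x j) : 0 < groundEnergy L x :=
  lt_groundEnergy_iff.2 fun j => energy_pos (hg j) 0

lemma isChemPot_iff : IsChemPot L x β ρ μ ↔ μ < groundEnergy L x ∧ density L x β μ = ρ :=
  and_congr_left' ⟨fun h => lt_groundEnergy_iff.2 fun j => h j 0, lt_energy_of_lt_groundEnergy⟩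

lemma length_pos_of_gap_pos (hg : ∀ j, 0 < gap L x j) : 0 < L :=
  sum_gap (L := L) (x := x) ▸ Finset.sum_pos (fun j _ => hg j) Finset.univ_nonempty

lemma summable_occ_gap (hβ : 0 < β) (hg : ∀ j, 0 < gap L x j) (h : μ < groundEnergy L x)
    (j : Fin (N + 1)) : Summable fun s : ℕ => occ β μ (energy (gap L x j) (s + 1)) :=
  summable_occ hβ (hg j) (lt_groundEnergy_iff.1 h j)

lemma density_eq_cutoffSum (β μ : ℝ) (hg : ∀ j, 0 < gap L x j) :
    density L x β μ = 1 / L * ∑ j, cutoffSum β 0 μ 1 (gap L x j) := by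
  simp only [density, cutoffSum_zero_one β μ (hg _)]

lemma strictMonoOn_density (hβ : 0 < β) (hg : ∀ j, 0 < gap L x j) :
    StrictMonoOn (density L x β) (Iio (groundEnergy L x)) := by
  intro μ hμ ν hν hlt
  have hL := length_pos_of_gap_pos hg
  have hocc (j : Fin (N + 1)) (s : ℕ) :
      occ β μ (energy (gap L x j) (s + 1)) < occ β ν (energy (gap L x j) (s + 1)) :=
    strictMonoOn_occ hβ _ (lt_energy_of_lt_groundEnergy hμ j s)
      (lt_energy_of_lt_groundEnergy hν j s) hlt
  unfold density
  gcongr with j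
  · exact Finset.univ_nonempty
  · exact (summable_occ_gap hβ hg hμ j).tsum_lt_tsum (i := 0) (fun s => (hocc j s).le) (hocc j 0)
      (summable_occ_gap hβ hg hν j)

lemma continuousOn_density (hβ : 0 < β) (hg : ∀ j, 0 < gap L x j) :
    ContinuousOn (density L x β) (Iio (groundEnergy L x)) := by
  intro μ hμ
  refine ContinuousAt.continuousWithinAt <|
    continuousAt_const.mul <| tendsto_finsetSum _ fun j _ => ?_
  obtain ⟨κ, hμκ, hκ⟩ := exists_between (mem_Iio.1 hμ)
  refine tendsto_tsum_of_dominated_convergence (summable_occ_gap hβ hg hκ j)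
    (fun s => continuousAt_occ_left hβ (lt_energy_of_lt_groundEnergy hμ j s)) ?_
  filter_upwards [Iio_mem_nhds hμκ] with ν hν s
  have hκE := lt_energy_of_lt_groundEnergy hκ j s
  have hνE := (mem_Iio.1 hν).trans hκE
  rw [norm_of_nonneg (occ_pos hβ hνE).le]
  exact (strictMonoOn_occ hβ _).monotoneOn hνE hκE (le_of_lt hν)

lemma abs_one_div_mul_sum_gap_le (hg : ∀ j, 0 < gap L x j) {f : ℝ → ℝ} {K c : ℝ}
    (hf : ∀ ℓ, 0 < ℓ → |f ℓ| ≤ K * (ℓ / c)) : |1 / L * ∑ j, f (gap L x j)| ≤ K * (1 / c) := by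
  have hL := length_pos_of_gap_pos hg
  rw [abs_mul, abs_of_pos (one_div_pos.2 hL), one_div_mul_eq_div, div_le_iff₀ hL]
  calc |∑ j, f (gap L x j)| ≤ ∑ j, |f (gap L x j)| := Finset.abs_sum_le_sum_abs _ _
    _ ≤ ∑ j, K * (gap L x j / c) := Finset.sum_le_sum fun j _ => hf _ (hg j)
    _ = K * (1 / c) * L := by rw [← Finset.mul_sum, ← Finset.sum_div, sum_gap]; ring

lemma continuousAt_boltzmannConst (hβ : 0 < β) (h : μ < ε) :
    ContinuousAt (boltzmannConst β ε) μ := by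
  unfold boltzmannConst
  exact ContinuousAt.div (by fun_prop) (by fun_prop) (one_sub_exp_neg_mul_sub_pos hβ h).ne'

lemma tendsto_boltzmannConst_atBot (hβ : 0 < β) :
    Tendsto (boltzmannConst β ε) atBot (𝓝 0) := by
  have hnum : Tendsto (fun μ => exp (β * μ)) atBot (𝓝 0) :=
    tendsto_exp_atBot.comp (tendsto_id.const_mul_atBot hβ)
  have hden : Tendsto (fun μ => 1 - exp (-(β * (ε - μ)))) atBot (𝓝 1) := by
    have : Tendsto (fun μ => exp (-(β * ε)) * exp (β * μ)) atBot (𝓝 0) := by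
      simpa only [mul_zero] using hnum.const_mul (exp (-(β * ε)))
    simpa only [← exp_add, sub_zero, mul_sub, neg_sub, neg_add_eq_sub] using this.const_sub 1
  have hquot := hnum.div hden one_ne_zero
  rwa [zero_div] at hquot

lemma tendsto_density_atBot (hβ : 0 < β) (hg : ∀ j, 0 < gap L x j) :
    Tendsto (density L x β) atBot (𝓝 0) := by
  have hbound : Tendsto (fun μ => boltzmannConst β 0 μ * (1 / √(2 * π * β))) atBot (𝓝 0) := by
    simpa only [zero_mul] using (tendsto_boltzmannConst_atBot hβ).mul_const (1 / √(2 * π * β))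
  refine squeeze_zero_norm' ?_ hbound
  filter_upwards [eventually_lt_atBot 0] with μ hμ
  rw [density_eq_cutoffSum β μ hg]
  exact abs_one_div_mul_sum_gap_le hg fun ℓ hℓ => abs_cutoffSum_le hβ hμ hℓ fun _ => abs_one.le

lemma tendsto_occ_left_atTop (hβ : 0 < β) (E : ℝ) :
    Tendsto (fun μ => occ β μ E) (𝓝[<] E) atTop := by
  simp only [occ, one_div]
  refine Tendsto.inv_tendsto_nhdsGT_zero (tendsto_nhdsWithin_iff.2 ⟨?_, ?_⟩)
  · have : Continuous fun μ => exp (β * (E - μ)) - 1 := by fun_prop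
    simpa using (this.tendsto E).mono_left nhdsWithin_le_nhds
  · filter_upwards [self_mem_nhdsWithin] with μ hμ using sub_pos.2 (one_lt_exp_mul_sub hβ hμ)

lemma occ_le_density (hβ : 0 < β) (hg : ∀ j, 0 < gap L x j) (h : μ < groundEnergy L x)
    (j : Fin (N + 1)) : 1 / L * occ β μ (energy (gap L x j) 1) ≤ density L x β μ := by
  have hL := length_pos_of_gap_pos hg
  have hocc (i : Fin (N + 1)) (s : ℕ) : 0 ≤ occ β μ (energy (gap L x i) (s + 1)) :=
    (occ_pos hβ (lt_energy_of_lt_groundEnergy h i s)).le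
  unfold density
  gcongr
  calc occ β μ (energy (gap L x j) 1) ≤ ∑' s : ℕ, occ β μ (energy (gap L x j) (s + 1)) :=
        (summable_occ_gap hβ hg h j).le_tsum 0 fun s _ => hocc j s
    _ ≤ ∑ i, ∑' s : ℕ, occ β μ (energy (gap L x i) (s + 1)) :=
        Finset.single_le_sum (f := fun i => ∑' s : ℕ, occ β μ (energy (gap L x i) (s + 1)))
          (fun i _ => tsum_nonneg (hocc i)) (Finset.mem_univ j)

lemma tendsto_density_groundEnergy (hβ : 0 < β) (hg : ∀ j, 0 < gap L x j) :
    Tendsto (density L x β) (𝓝[<] groundEnergy L x) atTop := by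
  obtain ⟨j, -, hj⟩ := Finset.exists_mem_eq_inf' Finset.univ_nonempty
    fun j => energy (gap L x j) 1
  refine tendsto_atTop_mono' _ ?_ ((tendsto_occ_left_atTop hβ (groundEnergy L x)).const_mul_atTop
    (one_div_pos.2 (length_pos_of_gap_pos hg)))
  filter_upwards [self_mem_nhdsWithin] with μ hμ
  exact (congrArg (fun E => 1 / L * occ β μ E) hj).trans_le (occ_le_density hβ hg hμ j)

lemma existsUnique_isChemPot (hβ : 0 < β) (hρ : 0 < ρ) (hg : ∀ j, 0 < gap L x j) :
    ∃! μ, IsChemPot L x β ρ μ := by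
  obtain ⟨μ, hμ, hμρ⟩ := isPreconnected_Iio.intermediate_value_Ioi
    (le_principal_iff.2 (Iio_mem_atBot (groundEnergy L x)))
    (le_principal_iff.2 self_mem_nhdsWithin) (continuousOn_density hβ hg)
    (tendsto_density_atBot hβ hg) (tendsto_density_groundEnergy hβ hg) hρ
  refine ⟨μ, isChemPot_iff.2 ⟨hμ, hμρ⟩, fun ν hν => ?_⟩
  obtain ⟨hν, hνρ⟩ := isChemPot_iff.1 hν
  exact (strictMonoOn_density hβ hg).injOn hν hμ (hνρ.trans hμρ.symm)

lemma isChemPot_chemPot (h : ∃ μ, IsChemPot L x β ρ μ) :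
    IsChemPot L x β ρ (chemPot L x β ρ) := by
  rw [chemPot, dif_pos h]
  exact h.choose_spec

/-- The total occupation number of the levels of energy at most `ε` of an interval of length `ℓ`,
the complement of `cutoffSum β ε μ 1 ℓ`. -/
def lowSum (β ε μ ℓ : ℝ) : ℝ := ∑' s : ℕ, (Iic ε).indicator (occ β μ) (energy ℓ (s + 1))

lemma lowDensity_eq_lowSum (β ε μ : ℝ) :
    lowDensity L x β μ ε = 1 / L * ∑ j, lowSum β ε μ (gap L x j) := rfl

lemma lowSum_nonneg (hβ : 0 < β) (hμ : μ < energy ℓ 1) : 0 ≤ lowSum β ε μ ℓ :=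
  tsum_nonneg fun _ => indicator_apply_nonneg fun _ =>
    (occ_pos hβ (hμ.trans_le (energy_one_le ℓ _))).le

lemma summable_lowSum (hβ : 0 < β) (hε : μ < ε) (hℓ : 0 < ℓ) (hμ : μ < energy ℓ 1) :
    Summable fun s : ℕ => (Iic ε).indicator (occ β μ) (energy ℓ (s + 1)) :=
  ((summable_occ hβ hℓ hμ).sub (summable_cutoffOcc hβ hε hℓ)).congr fun _ =>
    sub_eq_of_eq_add (indicator_Iic_occ_add_cutoffOcc β ε μ _).symm

lemma density_eq_lowDensity_add (hβ : 0 < β) (hg : ∀ j, 0 < gap L x j) (hε : μ < ε)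
    (h : μ < groundEnergy L x) :
    density L x β μ = lowDensity L x β μ ε + 1 / L * ∑ j, cutoffSum β ε μ 1 (gap L x j) := by
  rw [density, lowDensity, ← mul_add, ← Finset.sum_add_distrib]
  refine congrArg _ (Finset.sum_congr rfl fun j _ => ?_)
  simp only [cutoffSum, Pi.one_apply, mul_one]
  rw [← (summable_lowSum hβ hε (hg j) (lt_groundEnergy_iff.1 h j)).tsum_add
    (summable_cutoffOcc hβ hε (hg j))]
  exact tsum_congr fun s => (indicator_Iic_occ_add_cutoffOcc β ε μ _).symm

end FiniteVolume

/-! ### The averaged density matrix -/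

section Eigenfun

variable {a b d : ℝ}

lemma measurable_eigenfun (a b : ℝ) (s : ℕ) : Measurable (eigenfun a b s) :=
  Measurable.indicator (by fun_prop) measurableSet_Ioo

lemma measurable_eigenfun_mul (a b : ℝ) (s : ℕ) (u v : ℝ) :
    Measurable fun z => eigenfun a b s (u + z) * eigenfun a b s (v + z) :=
  ((measurable_eigenfun a b s).comp (measurable_const_add u)).mul
    ((measurable_eigenfun a b s).comp (measurable_const_add v))

lemma abs_eigenfun_le (a b : ℝ) (s : ℕ) (w : ℝ) : |eigenfun a b s w| ≤ √(2 / (b - a)) := by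
  rw [eigenfun, ← norm_eq_abs]
  refine (norm_indicator_le_norm_self _ w).trans ?_
  rw [norm_eq_abs, abs_mul, abs_of_nonneg (sqrt_nonneg _)]
  exact mul_le_of_le_one_right (sqrt_nonneg _) (abs_sin_le_one _)

lemma abs_eigenfun_mul_le (hab : a ≤ b) (s : ℕ) (w w' : ℝ) :
    |eigenfun a b s w * eigenfun a b s w'| ≤ 2 / (b - a) := by
  rw [abs_mul, ← mul_self_sqrt (div_nonneg zero_le_two (sub_nonneg.2 hab))]
  gcongr <;> exact abs_eigenfun_le a b s _

lemma abs_eigenfun_mul_le_indicator (s : ℕ) (u z w : ℝ) :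
    |eigenfun a b s (u + z) * eigenfun a b s w| ≤
      (Ioo (a - u) (b - u)).indicator (fun _ => 2 / (b - a)) z := by
  by_cases hz : z ∈ Ioo (a - u) (b - u)
  · rw [indicator_of_mem hz]
    exact abs_eigenfun_mul_le (by linarith [hz.1, hz.2]) s _ w
  · have huz : u + z ∉ Ioo a b := fun h => hz ⟨by linarith [h.1], by linarith [h.2]⟩
    rw [indicator_of_notMem hz, eigenfun, indicator_of_notMem huz, zero_mul, abs_zero]

lemma integrable_eigenfun_mul (a b : ℝ) (s : ℕ) (u v : ℝ) :
    Integrable fun z => eigenfun a b s (u + z) * eigenfun a b s (v + z) := by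
  have hdom : Integrable ((Ioo (a - u) (b - u)).indicator fun _ => 2 / (b - a)) :=
    (integrable_indicator_iff measurableSet_Ioo).2 (integrableOn_const measure_Ioo_lt_top.ne)
  exact hdom.mono' (measurable_eigenfun_mul a b s u v).aestronglyMeasurable
    (.of_forall fun z => abs_eigenfun_mul_le_indicator s u z _)

lemma hasDerivAt_sin_mul_sin_primitive {k ℓ : ℝ} (hk : k ≠ 0) (a d w : ℝ) :
    HasDerivAt (fun w => 1 / ℓ * (w * cos (k * d) - sin (2 * k * (w - a) + k * d) / (2 * k)))
      (2 / ℓ * (sin (k * (w - a)) * sin (k * (w + d - a)))) w := by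
  have harg : HasDerivAt (fun w => 2 * k * (w - a) + k * d) (2 * k) w := by
    simpa using (((hasDerivAt_id w).sub_const a).const_mul (2 * k)).add_const (k * d)
  have hlin : HasDerivAt (fun w => w * cos (k * d)) (cos (k * d)) w := by
    simpa using (hasDerivAt_id w).mul_const (cos (k * d))
  refine ((hlin.sub (harg.sin.div_const (2 * k))).const_mul (1 / ℓ)).congr_deriv ?_
  have hdiff : k * d = k * (w + d - a) - k * (w - a) := by ring
  have hsum : 2 * k * (w - a) + k * d = k * (w + d - a) + k * (w - a) := by ring
  rw [hsum, hdiff, cos_sub, cos_add]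
  field_simp
  ring

lemma integral_sin_mul_sin {k ℓ : ℝ} (hk : k ≠ 0) (hℓ : ℓ ≠ 0)
    (hsin : sin (2 * (k * ℓ) - k * d) = -sin (k * d)) :
    ∫ w in a..(a + (ℓ - d)), 2 / ℓ * (sin (k * (w - a)) * sin (k * (w + d - a))) =
      (1 - d / ℓ) * cos (k * d) + sin (k * d) / (k * ℓ) := by
  have hend : 2 * k * (a + (ℓ - d) - a) + k * d = 2 * (k * ℓ) - k * d := by ring
  rw [intervalIntegral.integral_eq_sub_of_hasDerivAt
    (fun w _ => hasDerivAt_sin_mul_sin_primitive hk a d w)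
    (Continuous.intervalIntegrable (by fun_prop) _ _), hend, hsin, sub_self, mul_zero, zero_add]
  field_simp
  ring

lemma eigenfun_mul_eigenfun_add (hd : 0 ≤ d) (s : ℕ) (z : ℝ) :
    eigenfun a b s z * eigenfun a b s (z + d) = (Ioo a (b - d)).indicator (fun z => 2 / (b - a) *
      (sin (π * s / (b - a) * (z - a)) * sin (π * s / (b - a) * (z + d - a)))) z := by
  unfold eigenfun
  by_cases hz : z ∈ Ioo a (b - d)
  · have hzb : z ∈ Ioo a b := ⟨hz.1, by linarith [hz.2]⟩
    have hzd : z + d ∈ Ioo a b := ⟨by linarith [hz.1], by linarith [hz.2]⟩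
    have hsq : √(2 / (b - a)) * √(2 / (b - a)) = 2 / (b - a) :=
      mul_self_sqrt (div_nonneg zero_le_two (by linarith [hzb.1, hzb.2]))
    rw [indicator_of_mem hz, indicator_of_mem hzb, indicator_of_mem hzd, mul_mul_mul_comm, hsq]
  · rw [indicator_of_notMem hz]
    by_cases hza : a < z
    · rw [indicator_of_notMem (a := z + d) fun h => hz ⟨hza, by linarith [h.2]⟩, mul_zero]
    · rw [indicator_of_notMem fun h => hza h.1, zero_mul]

lemma integral_eigenfun_mul_eigenfun_add (hab : a < b) (s : ℕ) (hd : 0 ≤ d) :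
    ∫ z, eigenfun a b (s + 1) z * eigenfun a b (s + 1) (z + d) = overlap d (b - a) s := by
  have hℓ : 0 < b - a := sub_pos.2 hab
  simp only [eigenfun_mul_eigenfun_add hd, Nat.cast_add_one]
  rw [integral_indicator measurableSet_Ioo]
  by_cases hdℓ : d ≤ b - a
  · have hkℓ : π * (s + 1) / (b - a) * (b - a) = π * (s + 1) := div_mul_cancel₀ _ hℓ.ne'
    have hperiod : 2 * (π * (s + 1)) = ((s + 1 : ℕ) : ℝ) * (2 * π) := by push_cast; ring
    rw [← integral_Ioc_eq_integral_Ioo, ← intervalIntegral.integral_of_le (by linarith),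
      show b - d = a + ((b - a) - d) by ring, integral_sin_mul_sin (by positivity) hℓ.ne',
      overlap, if_pos hdℓ, hkℓ]
    rw [hkℓ, hperiod, sin_nat_mul_two_pi_sub]
  · rw [overlap, if_neg hdℓ, Ioo_eq_empty (by linarith), setIntegral_empty]

lemma integral_eigenfun_mul (hab : a < b) (s : ℕ) (u v : ℝ) :
    ∫ z, eigenfun a b (s + 1) (u + z) * eigenfun a b (s + 1) (v + z) =
      overlap |u - v| (b - a) s := by
  wlog huv : u ≤ v generalizing u v
  · rw [abs_sub_comm, ← this v u (le_of_not_ge huv)]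
    simp only [mul_comm]
  rw [abs_sub_comm, abs_of_nonneg (sub_nonneg.2 huv),
    ← integral_eigenfun_mul_eigenfun_add hab s (sub_nonneg.2 huv),
    ← integral_add_left_eq_self (μ := volume)
      (fun z => eigenfun a b (s + 1) z * eigenfun a b (s + 1) (z + (v - u))) u]
  congr! 4
  ring

lemma abs_setIntegral_eigenfun_mul_sub_le (hab : a < b) (s : ℕ) (u v : ℝ) {S : Set ℝ}
    (hS : MeasurableSet S) :
    |(∫ z in S, eigenfun a b (s + 1) (u + z) * eigenfun a b (s + 1) (v + z)) -
      overlap |u - v| (b - a) s| ≤ 2 / (b - a) * volume.real (Ioo (a - u) (b - u) \ S) := by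
  have hint := integrable_eigenfun_mul a b (s + 1) u v
  have hdom : IntegrableOn ((Ioo (a - u) (b - u)).indicator fun _ => 2 / (b - a)) Sᶜ :=
    ((integrable_indicator_iff measurableSet_Ioo).2
      (integrableOn_const measure_Ioo_lt_top.ne)).integrableOn
  rw [← integral_eigenfun_mul hab s u v, ← integral_add_compl hS hint, sub_add_cancel_left, abs_neg]
  calc |∫ z in Sᶜ, eigenfun a b (s + 1) (u + z) * eigenfun a b (s + 1) (v + z)|
      ≤ ∫ z in Sᶜ, |eigenfun a b (s + 1) (u + z) * eigenfun a b (s + 1) (v + z)| :=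
        abs_integral_le_integral_abs
    _ ≤ ∫ z in Sᶜ, (Ioo (a - u) (b - u)).indicator (fun _ => 2 / (b - a)) z :=
        setIntegral_mono hint.abs.integrableOn hdom
          fun z => abs_eigenfun_mul_le_indicator (s + 1) u z _
    _ = 2 / (b - a) * volume.real (Ioo (a - u) (b - u) \ S) := by
        rw [setIntegral_indicator measurableSet_Ioo, setIntegral_const, smul_eq_mul, inter_comm,
          ← sdiff_eq, mul_comm]

lemma abs_mul_eigenfun_mul_le (hab : a ≤ b) (c : ℕ → ℝ) (s : ℕ) (w w' : ℝ) :
    |c s * (eigenfun a b (s + 1) w * eigenfun a b (s + 1) w')| ≤ |c s| * (2 / (b - a)) := by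
  rw [abs_mul]
  gcongr
  exact abs_eigenfun_mul_le hab _ w w'

lemma intervalIntegrable_tsum_eigenfun_mul (hab : a ≤ b) {c : ℕ → ℝ} (hc : Summable c)
    (u v p q : ℝ) :
    IntervalIntegrable (fun z => ∑' s, c s *
      (eigenfun a b (s + 1) (u + z) * eigenfun a b (s + 1) (v + z))) volume p q := by
  refine (intervalIntegrable_const (c := ∑' s, |c s| * (2 / (b - a)))).mono_fun'
    (Measurable.tsum fun s => (measurable_eigenfun_mul a b _ u v).const_mul _).aestronglyMeasurable
    (.of_forall fun z => ?_)
  exact tsum_of_norm_bounded (hc.abs.mul_right _).hasSum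
    fun s => abs_mul_eigenfun_mul_le hab c s _ _

lemma integral_tsum_eigenfun_mul (hab : a ≤ b) {c : ℕ → ℝ} (hc : Summable c) (u v p q : ℝ) :
    ∫ z in p..q, ∑' s, c s * (eigenfun a b (s + 1) (u + z) * eigenfun a b (s + 1) (v + z)) =
      ∑' s, c s * ∫ z in p..q, eigenfun a b (s + 1) (u + z) * eigenfun a b (s + 1) (v + z) := by
  have hbound (s : ℕ) (z : ℝ) := abs_mul_eigenfun_mul_le hab c s (u + z) (v + z)
  have hsum : Summable fun s => |c s| * (2 / (b - a)) := hc.abs.mul_right _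
  have := intervalIntegral.hasSum_integral_of_dominated_convergence (a := p) (b := q)
    (μ := volume) (fun s _ => |c s| * (2 / (b - a)))
    (fun s => ((measurable_eigenfun_mul a b (s + 1) u v).const_mul (c s)).aestronglyMeasurable)
    (fun s => .of_forall fun z _ => hbound s z) (.of_forall fun _ _ => hsum)
    intervalIntegrable_const
    (.of_forall fun z _ => (Summable.of_norm_bounded hsum fun s => hbound s z).hasSum)
  simp only [intervalIntegral.integral_const_mul] at this
  exact this.tsum_eq.symm

end Eigenfun

section LowEnergy

variable {β ε μ ℓ d δ w : ℝ} {s : ℕ}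

lemma abs_sub_one_le_of_abs_sub_overlap_le (hd : 0 ≤ d) (hℓ : 0 < ℓ) (hδ : 0 ≤ δ)
    (hw : |w - overlap d ℓ s| ≤ 2 / ℓ * δ) (hE : energy ℓ (s + 1) ≤ ε) :
    |w - 1| ≤ d ^ 2 * ε + 2 * d * √ε + 2 * δ * √ε := by
  have hsmall : 2 / ℓ * δ ≤ 2 * δ * √ε := by
    calc 2 / ℓ * δ = 2 * δ * (1 / ℓ) := by ring
      _ ≤ 2 * δ * √ε := by gcongr; exact one_div_le_sqrt_of_energy_le s hE
  linarith [abs_sub_le w (overlap d ℓ s) 1, abs_overlap_sub_one_le hd hℓ s hE]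

lemma abs_occ_mul_sub_le (hβ : 0 < β) (hμ : μ < energy ℓ (s + 1)) (hd : 0 ≤ d) (hℓ : 0 < ℓ)
    (hδ : 0 ≤ δ) (hw : |w - overlap d ℓ s| ≤ 2 / ℓ * δ) :
    |occ β μ (energy ℓ (s + 1)) * w - (cutoffOcc β ε μ (energy ℓ (s + 1)) * overlap d ℓ s +
        (Iic ε).indicator (occ β μ) (energy ℓ (s + 1)))| ≤
      (Iic ε).indicator (occ β μ) (energy ℓ (s + 1)) * (d ^ 2 * ε + 2 * d * √ε + 2 * δ * √ε) +
        cutoffOcc β ε μ (energy ℓ (s + 1)) * (2 / ℓ * δ) := by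
  have hocc := occ_pos hβ hμ
  rcases le_or_gt (energy ℓ (s + 1)) ε with hE | hE
  · rw [cutoffOcc_of_le hE, indicator_of_mem (mem_Iic.2 hE), zero_mul, zero_mul, zero_add,
      add_zero, ← mul_sub_one, abs_mul, abs_of_pos hocc]
    gcongr
    exact abs_sub_one_le_of_abs_sub_overlap_le hd hℓ hδ hw hE
  · rw [cutoffOcc_of_lt hE, indicator_of_notMem (notMem_Iic.2 hE), zero_mul, zero_add, add_zero,
      ← mul_sub, abs_mul, abs_of_pos hocc]
    gcongr

lemma abs_tsum_sub_tsum_le {f g h : ℕ → ℝ} (hg : Summable g) (hh : Summable h)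
    (hle : ∀ s, |f s - g s| ≤ h s) : |∑' s, f s - ∑' s, g s| ≤ ∑' s, h s := by
  have hf : Summable f :=
    ((Summable.of_norm_bounded hh hle).add hg).congr fun s => sub_add_cancel (f s) (g s)
  rw [← hf.tsum_sub hg]
  exact tsum_of_norm_bounded (f := fun s => f s - g s) hh.hasSum hle

lemma abs_tsum_occ_mul_sub_le (hβ : 0 < β) (hε : μ < ε) (hℓ : 0 < ℓ) (hμ : μ < energy ℓ 1)
    (hd : 0 ≤ d) (hδ : 0 ≤ δ) {w : ℕ → ℝ} (hw : ∀ s, |w s - overlap d ℓ s| ≤ 2 / ℓ * δ) :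
    |∑' s : ℕ, occ β μ (energy ℓ (s + 1)) * w s -
        (cutoffSum β ε μ (overlap d) ℓ + lowSum β ε μ ℓ)| ≤
      lowSum β ε μ ℓ * (d ^ 2 * ε + 2 * d * √ε + 2 * δ * √ε) +
        2 * (boltzmannConst β ε μ * (1 / √(2 * π * β))) * δ := by
  have hlow := summable_lowSum hβ hε hℓ hμ
  have hcut := summable_cutoffOcc hβ hε hℓ
  have hover := summable_cutoffOcc_mul hβ hε hℓ (abs_overlap_le_one hd hℓ)
  have hcutSum : ∑' s : ℕ, cutoffOcc β ε μ (energy ℓ (s + 1)) ≤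
      boltzmannConst β ε μ * (ℓ / √(2 * π * β)) := by
    simpa only [cutoffSum, Pi.one_apply, mul_one] using
      (le_abs_self _).trans (abs_cutoffSum_le hβ hε hℓ (a := 1) fun _ => abs_one.le)
  unfold cutoffSum lowSum at *
  rw [← hover.tsum_add hlow]
  refine (abs_tsum_sub_tsum_le (hover.add hlow) ((hlow.mul_right _).add (hcut.mul_right _))
    fun s => abs_occ_mul_sub_le hβ (hμ.trans_le (energy_one_le ℓ s)) hd hℓ hδ (hw s)).trans ?_
  rw [(hlow.mul_right _).tsum_add (hcut.mul_right _), tsum_mul_right, tsum_mul_right]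
  refine add_le_add le_rfl ?_
  calc (∑' s : ℕ, cutoffOcc β ε μ (energy ℓ (s + 1))) * (2 / ℓ * δ)
      ≤ boltzmannConst β ε μ * (ℓ / √(2 * π * β)) * (2 / ℓ * δ) := by gcongr
    _ = 2 * (boltzmannConst β ε μ * (1 / √(2 * π * β))) * δ := by field_simp

end LowEnergy

section AvgDensityMatrix

variable {N : ℕ} {L β ε μ : ℝ} {x : Fin N → ℝ}

/-- The length of the part of the `j`-th interval, translated by `-u`, which sticks out of the
volume. -/
def lostLength (L : ℝ) (x : Fin N → ℝ) (u : ℝ) (j : Fin (N + 1)) : ℝ :=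
  volume.real (Ioo (left L x j - u) (right L x j - u) \ Ioc (-L / 2) (L / 2))

/-- The overlap of the translates by `u` and `v` of the eigenfunction `s + 1` of the `j`-th
interval, restricted to the volume. -/
def boxOverlap (L : ℝ) (x : Fin N → ℝ) (u v : ℝ) (j : Fin (N + 1)) (s : ℕ) : ℝ :=
  ∫ z in (-L / 2)..(L / 2), eigenfun (left L x j) (right L x j) (s + 1) (u + z) *
    eigenfun (left L x j) (right L x j) (s + 1) (v + z)

lemma lostLength_nonneg (u : ℝ) (j : Fin (N + 1)) : 0 ≤ lostLength L x u j := measureReal_nonneg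

lemma volume_Icc_sub_sdiff_Ioc_le (a b u : ℝ) :
    volume.real (Icc (a - u) (b - u) \ Ioc a b) ≤ |u| := by
  rcases le_or_gt 0 u with hu | hu
  · have hsub : Icc (a - u) (b - u) \ Ioc a b ⊆ Icc (a - u) a := fun z hz =>
      ⟨hz.1.1, not_lt.1 fun h => hz.2 ⟨h, by linarith [hz.1.2]⟩⟩
    refine (measureReal_mono hsub measure_Icc_lt_top.ne).trans_eq ?_
    rw [volume_real_Icc_of_le (by linarith), abs_of_nonneg hu, sub_sub_cancel]
  · have hsub : Icc (a - u) (b - u) \ Ioc a b ⊆ Icc b (b - u) := fun z hz =>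
      ⟨not_lt.1 fun h => hz.2 ⟨by linarith [hz.1.1], h.le⟩, hz.1.2⟩
    refine (measureReal_mono hsub measure_Icc_lt_top.ne).trans_eq ?_
    rw [volume_real_Icc_of_le (by linarith), abs_of_neg hu, sub_sub_cancel_left]

lemma sum_lostLength_le (hg : ∀ j, 0 ≤ gap L x j) (u : ℝ) :
    ∑ j, lostLength L x u j ≤ |u| := by
  have hdisj : Pairwise (Function.onFun Disjoint
      fun j : Fin (N + 1) => Ioo (left L x j - u) (right L x j - u)) :=
    (pairwise_disjoint_on _).2 fun j k hjk => disjoint_left.2 fun z hj hk =>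
      absurd (right_le_left hg hjk) (by linarith [hj.2, hk.1])
  set T := Icc (-L / 2 - u) (L / 2 - u) \ Ioc (-L / 2) (L / 2) with hT
  have hlost (j : Fin (N + 1)) : lostLength L x u j =
      (volume.restrict T).real (Ioo (left L x j - u) (right L x j - u)) := by
    have hsub : Ioo (left L x j - u) (right L x j - u) ⊆ Icc (-L / 2 - u) (L / 2 - u) :=
      fun z hz => ⟨by linarith [neg_half_le_left hg j, hz.1],
        by linarith [right_le_half hg j, hz.2]⟩
    rw [measureReal_restrict_apply measurableSet_Ioo, hT, ← inter_sdiff_assoc,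
      inter_eq_left.2 hsub, lostLength]
  have : IsFiniteMeasure (volume.restrict T) :=
    isFiniteMeasure_restrict.2 (measure_ne_top_of_subset sdiff_subset measure_Icc_lt_top.ne)
  simp only [hlost]
  refine (sum_measureReal_le_measureReal_univ (fun j _ => measurableSet_Ioo)
    (hdisj.set_pairwise _)).trans ?_
  rw [measureReal_restrict_apply_univ]
  exact volume_Icc_sub_sdiff_Ioc_le _ _ u

lemma lostLength_le (hg : ∀ j, 0 ≤ gap L x j) (u : ℝ) (j : Fin (N + 1)) :
    lostLength L x u j ≤ |u| :=
  (Finset.single_le_sum (fun k _ => lostLength_nonneg u k) (Finset.mem_univ j)).trans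
    (sum_lostLength_le hg u)

lemma abs_boxOverlap_sub_le (hL : 0 ≤ L) {j : Fin (N + 1)} (hg : 0 < gap L x j) (u v : ℝ)
    (s : ℕ) :
    |boxOverlap L x u v j s - overlap |u - v| (gap L x j) s| ≤
      2 / gap L x j * lostLength L x u j := by
  rw [boxOverlap, intervalIntegral.integral_of_le (by linarith)]
  exact abs_setIntegral_eigenfun_mul_sub_le (sub_pos.1 hg) s u v measurableSet_Ioc

lemma avgDensityMatrix_eq (hβ : 0 < β) (hg : ∀ j, 0 < gap L x j) (h : μ < groundEnergy L x)
    (u v : ℝ) :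
    avgDensityMatrix L x β μ u v = 1 / L * ∑ j, ∑' s : ℕ,
      occ β μ (energy (gap L x j) (s + 1)) * boxOverlap L x u v j s := by
  have hle (j : Fin (N + 1)) : left L x j ≤ right L x j := sub_nonneg.1 (hg j).le
  unfold avgDensityMatrix densityMatrix
  rw [intervalIntegral.integral_finsetSum fun j _ =>
    intervalIntegrable_tsum_eigenfun_mul (hle j) (summable_occ_gap hβ hg h j) u v _ _]
  simp only [integral_tsum_eigenfun_mul (hle _) (summable_occ_gap hβ hg h _), boxOverlap]

lemma abs_avgDensityMatrix_sub_le (hβ : 0 < β) (hg : ∀ j, 0 < gap L x j) (hε : μ < ε)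
    (h : μ < groundEnergy L x) (u v : ℝ) :
    |avgDensityMatrix L x β μ u v -
      (1 / L * ∑ j, cutoffSum β ε μ (overlap |u - v|) (gap L x j) + lowDensity L x β μ ε)| ≤
      lowDensity L x β μ ε * (|u - v| ^ 2 * ε + 2 * |u - v| * √ε + 2 * |u| * √ε) +
        2 * (boltzmannConst β ε μ * (1 / √(2 * π * β))) * |u| / L := by
  have hL := length_pos_of_gap_pos hg
  have hg' (j : Fin (N + 1)) : 0 ≤ gap L x j := (hg j).le
  set η := |u - v| ^ 2 * ε + 2 * |u - v| * √ε + 2 * |u| * √ε with hη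
  set K := boltzmannConst β ε μ * (1 / √(2 * π * β))
  have hK : 0 ≤ K := mul_nonneg (boltzmannConst_pos hβ hε).le (by positivity)
  have hterm (j : Fin (N + 1)) :
      |∑' s : ℕ, occ β μ (energy (gap L x j) (s + 1)) * boxOverlap L x u v j s -
        (cutoffSum β ε μ (overlap |u - v|) (gap L x j) + lowSum β ε μ (gap L x j))| ≤
      lowSum β ε μ (gap L x j) * η + 2 * K * lostLength L x u j := by
    have hlow : 0 ≤ lowSum β ε μ (gap L x j) :=
      lowSum_nonneg hβ (lt_groundEnergy_iff.1 h j)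
    refine (abs_tsum_occ_mul_sub_le hβ hε (hg j) (lt_groundEnergy_iff.1 h j) (abs_nonneg _)
      (lostLength_nonneg u j) (abs_boxOverlap_sub_le hL.le (hg j) u v)).trans ?_
    rw [hη]
    gcongr
    exact lostLength_le hg' u j
  rw [avgDensityMatrix_eq hβ hg h, lowDensity_eq_lowSum, ← mul_add, ← Finset.sum_add_distrib,
    ← mul_sub, ← Finset.sum_sub_distrib, abs_mul, abs_of_pos (one_div_pos.2 hL)]
  calc _ ≤ 1 / L * ∑ j, (lowSum β ε μ (gap L x j) * η + 2 * K * lostLength L x u j) := by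
        gcongr
        exact (Finset.abs_sum_le_sum_abs _ _).trans (Finset.sum_le_sum fun j _ => hterm j)
    _ = 1 / L * (∑ j, lowSum β ε μ (gap L x j)) * η + 2 * K * (∑ j, lostLength L x u j) / L := by
        rw [Finset.sum_add_distrib, ← Finset.sum_mul, ← Finset.mul_sum]; ring
    _ ≤ 1 / L * (∑ j, lowSum β ε μ (gap L x j)) * η + 2 * K * |u| / L := by
        gcongr
        exact sum_lostLength_le hg' u

end AvgDensityMatrix

/-! ### The thermodynamic limit -/

lemma tendsto_of_eventually_abs_sub_le {ι κ : Type*} {F : Filter ι} {G : Filter κ} [G.NeBot]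
    {f : ι → ℝ} {A B : κ → ι → ℝ} {α b : κ → ℝ} {c : ℝ}
    (hA : ∀ᶠ k in G, Tendsto (A k) F (𝓝 (α k))) (hB : ∀ᶠ k in G, Tendsto (B k) F (𝓝 (b k)))
    (hle : ∀ᶠ k in G, ∀ᶠ i in F, |f i - A k i| ≤ B k i)
    (hα : Tendsto α G (𝓝 c)) (hb : Tendsto b G (𝓝 0)) : Tendsto f F (𝓝 c) := by
  rw [Metric.tendsto_nhds]
  intro η hη
  have hη3 : 0 < η / 3 := by positivity
  obtain ⟨k, hAk, hBk, hlek, hαk, hbk⟩ := (hA.and <| hB.and <| hle.and <|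
    (Metric.tendsto_nhds.1 hα _ hη3).and <| hb.eventually_lt_const hη3).exists
  filter_upwards [Metric.tendsto_nhds.1 hAk _ hη3, hBk.eventually_lt_const hbk, hlek]
    with i hAi hBi hlei
  linarith [dist_triangle4 (f i) (A k i) (α k) c, Real.dist_eq (f i) (A k i)]

lemma tendsto_energy_atTop (s : ℕ) : Tendsto (fun ℓ => energy ℓ s) atTop (𝓝 0) := by
  unfold energy
  have hdiv : Tendsto (fun ℓ : ℝ => π ^ 2 * (s : ℝ) ^ 2 / ℓ ^ 2) atTop (𝓝 0) :=
    tendsto_const_nhds.div_atTop (tendsto_pow_atTop two_ne_zero)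
  simpa only [mul_zero] using hdiv.const_mul (1 / 2)

lemma critDensity_nonneg {lam β : ℝ} (hlam : 0 < lam) (hβ : 0 < β) : 0 ≤ critDensity lam β :=
  critDensity_eq hlam hβ ▸ limCutoffDensity_nonneg lam hβ le_rfl

/-- The almost sure properties of the impurity configurations from which the thermodynamic limits
are derived: the intervals are nondegenerate and, for the countably many rational `t > 0`, the
density of the positions of an impurity-free window of length `t` converges. -/
structure IsTypical (lam : ℝ) (L : ℕ → ℝ) (x : (N : ℕ) → Fin N → ℝ) : Prop where
  gap_pos : ∀ N j, 0 < gap (L N) (x N) j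
  tendsto_excess : ∀ t : ℚ, 0 < t →
    Tendsto (fun N => 1 / L N * ∑ j, max (gap (L N) (x N) j - t) 0) atTop (𝓝 (exp (-(lam * t))))

lemma ae_isTypical {Ω : Type*} [MeasurableSpace Ω] {P : Measure Ω} [IsProbabilityMeasure P]
    {lam : ℝ} {L : ℕ → ℝ} {X : (N : ℕ) → Fin N → Ω → ℝ} (hL : ∀ N, 0 < L N)
    (hLlam : Tendsto (fun N : ℕ => ((N : ℝ) + 1) / L N) atTop (𝓝 lam))
    (hXmeas : ∀ N i, Measurable (X N i))
    (hXunif : ∀ N i, pdf.IsUniform (X N i) (Icc (-L N / 2) (L N / 2)) P volume)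
    (hXindep : ∀ N, iIndepFun (X N) P) : ∀ᵐ ω ∂P, IsTypical lam L fun N i => X N i ω := by
  have hgap : ∀ᵐ ω ∂P, ∀ N j, 0 < gap (L N) (fun i => X N i ω) j :=
    ae_all_iff.2 fun N => ae_gap_pos (hL N) (hXmeas N) (hXunif N) (hXindep N)
  have hwindow : ∀ᵐ ω ∂P, ∀ t : ℚ, 0 < t → Tendsto
      (fun N => 1 / L N * volume.real (emptyWindows (L N) t fun i => X N i ω)) atTop
      (𝓝 (exp (-(lam * t)))) :=
    ae_all_iff.2 fun t => eventually_imp_distrib_left.2 fun ht =>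
      ae_tendsto_emptyWindows hL hLlam hXmeas hXunif hXindep (Rat.cast_pos.2 ht)
  filter_upwards [hgap, hwindow] with ω hgω hwω
  refine ⟨hgω, fun t ht => (hwω t ht).congr fun N => ?_⟩
  rw [volume_emptyWindows (Rat.cast_pos.2 ht) fun j => (hgω N j).le]

namespace IsTypical

variable {lam β ρ ε μ : ℝ} {L : ℕ → ℝ} {x : (N : ℕ) → Fin N → ℝ} {m : ℕ → ℝ} {a : ℝ → ℕ → ℝ}

lemma tendsto_cutoffSum (hx : IsTypical lam L x) (hlam : 0 < lam) (hβ : 0 < β) (h : μ < ε)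
    (ham : ∀ s, Measurable (fun ℓ => a ℓ s)) (ha : ∀ ℓ, 0 < ℓ → ∀ s, |a ℓ s| ≤ 1)
    (hac : ∀ᵐ ℓ ∂volume.restrict (Ioi (0 : ℝ)), ∀ s, ContinuousAt (fun ℓ => a ℓ s) ℓ) :
    Tendsto (fun N => 1 / L N * ∑ j, cutoffSum β ε μ a (gap (L N) (x N) j)) atTop
      (𝓝 (limCutoffDensity lam β ε μ a)) := by
  refine tendsto_sum_of_tendsto_excess hlam (fun N => length_pos_of_gap_pos (hx.gap_pos N))
    hx.gap_pos (fun N => sum_gap) hx.tendsto_excess (measurable_cutoffSum β ε μ ham)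
    (C := boltzmannConst β ε μ / √(2 * π * β)) (fun ℓ hℓ => ?_) ?_
  · exact (abs_cutoffSum_le hβ h hℓ (ha ℓ hℓ)).trans_eq (by ring)
  · filter_upwards [hac, ae_energy_ne ε, ae_restrict_mem measurableSet_Ioi] with ℓ hcont hne hℓ
    exact continuousAt_cutoffSum hβ h hℓ ha hcont hne

lemma tendsto_cutoffSum_of_tendsto (hx : IsTypical lam L x) (hlam : 0 < lam) (hβ : 0 < β)
    (h : μ < ε) (hm : Tendsto m atTop (𝓝 μ))
    (ham : ∀ s, Measurable (fun ℓ => a ℓ s)) (ha : ∀ ℓ, 0 < ℓ → ∀ s, |a ℓ s| ≤ 1)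
    (hac : ∀ᵐ ℓ ∂volume.restrict (Ioi (0 : ℝ)), ∀ s, ContinuousAt (fun ℓ => a ℓ s) ℓ) :
    Tendsto (fun N => 1 / L N * ∑ j, cutoffSum β ε (m N) a (gap (L N) (x N) j)) atTop
      (𝓝 (limCutoffDensity lam β ε μ a)) := by
  have hbound : ∀ᶠ N in atTop, ‖1 / L N * ∑ j, cutoffSum β ε (m N) a (gap (L N) (x N) j) -
      1 / L N * ∑ j, cutoffSum β ε μ a (gap (L N) (x N) j)‖ ≤
      boltzmannConst β ε (m N) * boltzmannConst β ε μ *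
        |exp (-(β * μ)) - exp (-(β * m N))| * (1 / √(2 * π * β)) := by
    filter_upwards [hm.eventually_lt_const h] with N hN
    rw [← mul_sub, ← Finset.sum_sub_distrib]
    exact abs_one_div_mul_sum_gap_le (hx.gap_pos N)
      (f := fun ℓ => cutoffSum β ε (m N) a ℓ - cutoffSum β ε μ a ℓ)
      fun ℓ hℓ => abs_cutoffSum_sub_le hβ hN h hℓ (ha ℓ hℓ)
  have hcont : ContinuousAt (fun ν => boltzmannConst β ε ν * boltzmannConst β ε μ *
      |exp (-(β * μ)) - exp (-(β * ν))| * (1 / √(2 * π * β))) μ :=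
    (((continuousAt_boltzmannConst hβ h).mul_const _).mul (by fun_prop)).mul_const _
  have herror := hcont.tendsto.comp hm
  simp only [sub_self, abs_zero, mul_zero, zero_mul] at herror
  simpa only [sub_add_cancel, zero_add] using
    (squeeze_zero_norm' hbound herror).add (hx.tendsto_cutoffSum hlam hβ h ham ha hac)

lemma tendsto_density (hx : IsTypical lam L x) (hlam : 0 < lam) (hβ : 0 < β) (hμ : μ < 0) :
    Tendsto (fun N => density (L N) (x N) β μ) atTop (𝓝 (limCutoffDensity lam β 0 μ 1)) := by
  simp only [density_eq_cutoffSum β μ (hx.gap_pos _)]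
  exact hx.tendsto_cutoffSum hlam hβ hμ (fun _ => measurable_const) (fun _ _ _ => abs_one.le)
    (.of_forall fun _ _ => continuousAt_const)

lemma eventually_exists_lt_gap (hx : IsTypical lam L x) {t : ℚ} (ht : 0 < t) :
    ∀ᶠ N in atTop, ∃ j, (t : ℝ) < gap (L N) (x N) j := by
  filter_upwards [(hx.tendsto_excess t ht).eventually_const_lt (exp_pos _)] with N hN
  contrapose! hN
  rw [Finset.sum_eq_zero fun j _ => max_eq_right (sub_nonpos.2 (hN j)), mul_zero]

lemma tendsto_groundEnergy (hx : IsTypical lam L x) :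
    Tendsto (fun N => groundEnergy (L N) (x N)) atTop (𝓝 0) := by
  have hpos (N : ℕ) := groundEnergy_pos (hx.gap_pos N)
  refine tendsto_order.2 ⟨fun δ hδ => .of_forall fun N => hδ.trans (hpos N), fun δ hδ => ?_⟩
  obtain ⟨n, hn, hn0⟩ := ((((tendsto_energy_atTop 1).comp
    tendsto_natCast_atTop_atTop).eventually_lt_const hδ).and (eventually_gt_atTop 0)).exists
  filter_upwards [hx.eventually_exists_lt_gap (t := n) (Nat.cast_pos.2 hn0)] with N ⟨j, hj⟩
  rw [Rat.cast_natCast] at hj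
  have hn' : (0 : ℝ) < n := Nat.cast_pos.2 hn0
  exact (Finset.inf'_le _ (Finset.mem_univ j)).trans_lt
    ((strictAntiOn_energy 0 hn' (hn'.trans hj) hj).trans hn)

lemma existsUnique_isChemPot (hx : IsTypical lam L x) (hβ : 0 < β) (hρ : 0 < ρ) (N : ℕ) :
    ∃! μ, IsChemPot (L N) (x N) β ρ μ :=
  LuttingerSy.existsUnique_isChemPot hβ hρ (hx.gap_pos N)

lemma chemPot_lt_groundEnergy (hx : IsTypical lam L x) (hβ : 0 < β) (hρ : 0 < ρ) (N : ℕ) :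
    chemPot (L N) (x N) β ρ < groundEnergy (L N) (x N) :=
  (isChemPot_iff.1 (isChemPot_chemPot (hx.existsUnique_isChemPot hβ hρ N).exists)).1

lemma density_chemPot (hx : IsTypical lam L x) (hβ : 0 < β) (hρ : 0 < ρ) (N : ℕ) :
    density (L N) (x N) β (chemPot (L N) (x N) β ρ) = ρ :=
  (isChemPot_chemPot (hx.existsUnique_isChemPot hβ hρ N).exists).2

lemma tendsto_chemPot (hx : IsTypical lam L x) (hlam : 0 < lam) (hβ : 0 < β)
    (hρ : critDensity lam β < ρ) :
    Tendsto (fun N => chemPot (L N) (x N) β ρ) atTop (𝓝 0) := by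
  have hρ0 := (critDensity_nonneg hlam hβ).trans_lt hρ
  refine tendsto_order.2 ⟨fun δ hδ => ?_, fun δ hδ => ?_⟩
  · have hlim : limCutoffDensity lam β 0 δ 1 < ρ :=
      (limCutoffDensity_mono hlam hβ hδ.le le_rfl).trans_lt (critDensity_eq hlam hβ ▸ hρ)
    filter_upwards [(hx.tendsto_density hlam hβ hδ).eventually_lt_const hlim] with N hN
    rw [← hx.density_chemPot hβ hρ0 N] at hN
    exact ((strictMonoOn_density hβ (hx.gap_pos N)).lt_iff_lt
      (hδ.trans (groundEnergy_pos (hx.gap_pos N))) (hx.chemPot_lt_groundEnergy hβ hρ0 N)).1 hN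
  · filter_upwards [hx.tendsto_groundEnergy.eventually_lt_const hδ] with N hN
    exact (hx.chemPot_lt_groundEnergy hβ hρ0 N).trans hN

end IsTypical

/-- The thermodynamic limit of the density of the particles of energy at most `ε`. -/
def limLowDensity (lam β ρ ε : ℝ) : ℝ := ρ - limCutoffDensity lam β ε 0 1

lemma tendsto_limLowDensity {lam β : ℝ} (hlam : 0 < lam) (hβ : 0 < β) (ρ : ℝ) :
    Tendsto (limLowDensity lam β ρ) (𝓝[>] 0) (𝓝 (ρ - critDensity lam β)) := by
  rw [critDensity_eq hlam hβ]
  exact (tendsto_limCutoffDensity_zero hlam hβ (fun _ => measurable_const)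
    fun _ _ _ => abs_one.le).const_sub ρ

namespace IsTypical

variable {lam β ρ ε : ℝ} {L : ℕ → ℝ} {x : (N : ℕ) → Fin N → ℝ}

lemma tendsto_lowDensity (hx : IsTypical lam L x) (hlam : 0 < lam) (hβ : 0 < β)
    (hρ : critDensity lam β < ρ) (hε : 0 < ε) :
    Tendsto (fun N => lowDensity (L N) (x N) β (chemPot (L N) (x N) β ρ) ε) atTop
      (𝓝 (limLowDensity lam β ρ ε)) := by
  have hρ0 := (critDensity_nonneg hlam hβ).trans_lt hρ
  have hm := hx.tendsto_chemPot hlam hβ hρ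
  have hhigh := hx.tendsto_cutoffSum_of_tendsto hlam hβ hε hm (a := 1)
    (fun _ => measurable_const) (fun _ _ _ => abs_one.le) (.of_forall fun _ _ => continuousAt_const)
  refine (hhigh.const_sub ρ).congr' ?_
  filter_upwards [hm.eventually_lt_const hε] with N hN
  have hsplit := density_eq_lowDensity_add hβ (hx.gap_pos N) hN
    (hx.chemPot_lt_groundEnergy hβ hρ0 N)
  rw [hx.density_chemPot hβ hρ0 N] at hsplit
  exact sub_eq_of_eq_add hsplit

lemma tendsto_cutoffSum_overlap (hx : IsTypical lam L x) (hlam : 0 < lam) (hβ : 0 < β)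
    {m : ℕ → ℝ} (hε : 0 < ε) (hm : Tendsto m atTop (𝓝 0)) {d : ℝ} (hd : 0 ≤ d) :
    Tendsto (fun N => 1 / L N * ∑ j, cutoffSum β ε (m N) (overlap d) (gap (L N) (x N) j)) atTop
      (𝓝 (limCutoffDensity lam β ε 0 (overlap d))) := by
  refine hx.tendsto_cutoffSum_of_tendsto hlam hβ hε hm (measurable_overlap d)
    (fun ℓ hℓ => abs_overlap_le_one hd hℓ) ?_
  filter_upwards [ae_restrict_of_ae (Measure.ae_ne volume d), ae_restrict_mem measurableSet_Ioi]
    with ℓ hne hℓ using continuousAt_overlap (ne_of_gt hℓ) hne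

lemma tendsto_avgDensityMatrix (hx : IsTypical lam L x) (hlam : 0 < lam) (hβ : 0 < β)
    (hL : Tendsto L atTop atTop) (hρ : critDensity lam β < ρ) (u v : ℝ) :
    Tendsto (fun N => avgDensityMatrix (L N) (x N) β (chemPot (L N) (x N) β ρ) u v) atTop
      (𝓝 (limCutoffDensity lam β 0 0 (overlap |u - v|) + (ρ - critDensity lam β))) := by
  have hρ0 := (critDensity_nonneg hlam hβ).trans_lt hρ
  have hm := hx.tendsto_chemPot hlam hβ hρ
  let η : ℝ → ℝ := fun ε => |u - v| ^ 2 * ε + 2 * |u - v| * √ε + 2 * |u| * √ε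
  have hη : Tendsto η (𝓝[>] 0) (𝓝 0) := by
    have hcont : Continuous η := by fun_prop
    simpa [η] using (hcont.tendsto 0).mono_left nhdsWithin_le_nhds
  refine tendsto_of_eventually_abs_sub_le (G := 𝓝[>] 0)
    (b := fun ε => limLowDensity lam β ρ ε * η ε)
    (A := fun ε N => 1 / L N * ∑ j, cutoffSum β ε (chemPot (L N) (x N) β ρ) (overlap |u - v|)
      (gap (L N) (x N) j) + lowDensity (L N) (x N) β (chemPot (L N) (x N) β ρ) ε)
    (B := fun ε N => lowDensity (L N) (x N) β (chemPot (L N) (x N) β ρ) ε * η ε +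
      2 * (boltzmannConst β ε (chemPot (L N) (x N) β ρ) * (1 / √(2 * π * β))) * |u| / L N)
    (eventually_mem_nhdsWithin.mono fun ε hε =>
      (hx.tendsto_cutoffSum_overlap hlam hβ hε hm (abs_nonneg _)).add
        (hx.tendsto_lowDensity hlam hβ hρ hε))
    (eventually_mem_nhdsWithin.mono fun ε hε => ?_)
    (eventually_mem_nhdsWithin.mono fun ε hε => ?_)
    ((tendsto_limCutoffDensity_zero hlam hβ (measurable_overlap _)
      fun ℓ hℓ => abs_overlap_le_one (abs_nonneg _) hℓ).add (tendsto_limLowDensity hlam hβ ρ)) ?_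
  · have hconst := (continuousAt_boltzmannConst hβ hε).tendsto.comp hm
    simpa only [add_zero, Function.comp_def] using
      ((hx.tendsto_lowDensity hlam hβ hρ hε).mul_const (η ε)).add
        ((((hconst.mul_const _).const_mul 2).mul_const |u|).div_atTop hL)
  · filter_upwards [hm.eventually_lt_const hε] with N hN
    exact abs_avgDensityMatrix_sub_le hβ (hx.gap_pos N) hN
      (hx.chemPot_lt_groundEnergy hβ hρ0 N) u v
  · simpa only [mul_zero] using (tendsto_limLowDensity hlam hβ ρ).mul hη

end IsTypical

end LuttingerSy

end

theorem mainTheorem4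
    {Ω : Type*} [MeasurableSpace Ω] (P : Measure Ω) [IsProbabilityMeasure P]
    (lam β ρ : ℝ) (hlam : 0 < lam) (hβ : 0 < β)
    -- the volumes: `N` impurities, hence `N + 1` intervals, in `[-L N / 2, L N / 2]`
    (L : ℕ → ℝ) (hL : ∀ N, 0 < L N)
    (hLlam : Tendsto (fun N : ℕ => ((N : ℝ) + 1) / L N) atTop (𝓝 lam))
    -- for each `N`, the impurity positions are independent and uniform in the volume
    (X : (N : ℕ) → Fin N → Ω → ℝ)
    (hXmeas : ∀ N i, Measurable (X N i))
    (hXunif : ∀ N i, pdf.IsUniform (X N i) (Icc (-L N / 2) (L N / 2)) P volume)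
    (hXindep : ∀ N, iIndepFun (X N) P)
    (hρ : LuttingerSy.critDensity lam β < ρ) :
    -- the critical density is a genuine (finite) limit
    Tendsto (LuttingerSy.limDensity lam β) (𝓝[<] 0) (𝓝 (LuttingerSy.critDensity lam β)) ∧
    -- the finite-volume chemical potential is well defined, and converges to `0`
    (∀ᵐ ω ∂P, ∀ N,
      ∃! μ : ℝ, LuttingerSy.IsChemPot (L N) (fun i => X N i ω) β ρ μ) ∧
    (∀ᵐ ω ∂P,
      Tendsto (fun N => LuttingerSy.chemPot (L N) (fun i => X N i ω) β ρ) atTop (𝓝 0)) ∧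
    ∃ (ρ₀ : ℝ) (low : ℝ → ℝ) (ρlim : ℝ → ℝ → ℝ),
      -- `ρ₀` is the condensate density
      (∀ ε : ℝ, 0 < ε → ∀ᵐ ω ∂P,
        Tendsto (fun N => LuttingerSy.lowDensity (L N) (fun i => X N i ω) β
          (LuttingerSy.chemPot (L N) (fun i => X N i ω) β ρ) ε) atTop (𝓝 (low ε))) ∧
      Tendsto low (𝓝[>] 0) (𝓝 ρ₀) ∧
      ρ₀ = ρ - LuttingerSy.critDensity lam β ∧
      0 < ρ₀ ∧
      -- `ρlim` is the almost sure, nonrandom limit of the space-averaged density matrix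
      (∀ x y : ℝ, ∀ᵐ ω ∂P,
        Tendsto (fun N => LuttingerSy.avgDensityMatrix (L N) (fun i => X N i ω) β
          (LuttingerSy.chemPot (L N) (fun i => X N i ω) β ρ) x y) atTop (𝓝 (ρlim x y))) ∧
      -- off-diagonal long-range order
      Tendsto (fun p : ℝ × ℝ => ρlim p.1 p.2)
        (comap (fun p : ℝ × ℝ => |p.1 - p.2|) atTop) (𝓝 ρ₀) := by
  have htyp := LuttingerSy.ae_isTypical hL hLlam hXmeas hXunif hXindep
  have hLtop := LuttingerSy.tendsto_length_atTop hL hLlam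
  have hρ0 := (LuttingerSy.critDensity_nonneg hlam hβ).trans_lt hρ
  refine ⟨LuttingerSy.critDensity_eq hlam hβ ▸ LuttingerSy.tendsto_limDensity hlam hβ,
    htyp.mono fun ω hω => hω.existsUnique_isChemPot hβ hρ0,
    htyp.mono fun ω hω => hω.tendsto_chemPot hlam hβ hρ,
    ρ - LuttingerSy.critDensity lam β, LuttingerSy.limLowDensity lam β ρ,
    fun x y => LuttingerSy.limCutoffDensity lam β 0 0 (LuttingerSy.overlap |x - y|) +
      (ρ - LuttingerSy.critDensity lam β),
    fun ε hε => htyp.mono fun ω hω => hω.tendsto_lowDensity hlam hβ hρ hε,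
    LuttingerSy.tendsto_limLowDensity hlam hβ ρ, rfl, sub_pos.2 hρ,
    fun x y => htyp.mono fun ω hω => hω.tendsto_avgDensityMatrix hlam hβ hLtop hρ x y, ?_⟩
  have hoverlap := (LuttingerSy.tendsto_limCutoffDensity_overlap hlam hβ).comp
    (tendsto_comap (f := fun p : ℝ × ℝ => |p.1 - p.2|))
  simpa only [zero_add, Function.comp_def] using
    hoverlap.add_const (ρ - LuttingerSy.critDensity lam β)
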